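/- Let $k$ be an algebraically closed field. Let $Q$ be a finite connected quiver without loops and 2-cycles such that every arrow lies in a chordless cycle (a cyclic path without repeated vertices whose vertices span no further arrows, taken up to rotation), and such that the dual graph of $Q$ is a tree; the vertices of the dual graph are the chordless cycles and the boundary arrows (the arrows lying in exactly one chordless cycle), it has one edge between two distinct chordless cycles for every arrow they share, and one edge between a chordless cycle and each boundary arrow in it. Fix a chordless cycle $C_0$, let $d(C)$ be the distance from $C_0$ to $C$ in the dual graph, let $W=\sum_C(-1)^{d(C)}C$ be the sum over all chordless cycles, and let $B=kQ/(\partial_\alpha W : \alpha \text{ an arrow of } Q)$ be the Jacobian algebra of $(Q,W)$ (a dimer tree algebra); assume, as always for these algebras, that $B$ is finite-dimensional. Let $\operatorname{mod}B$ be the category of finitely generated right $B$-modules, and for a vertex $x$ of $Q$ let $P(x)=e_xB$ be the corresponding indecomposable projective module and $\operatorname{rad}P(x)$ its radical. Let $\operatorname{CMP}B\subseteq\operatorname{mod}B$ be the full subcategory of the modules $X$ with $\operatorname{Ext}^i_B(X,B)=0$ for all $i>0$, and let $\underline{\operatorname{CMP}}\,B$ be its stable category, obtained by identifying morphisms whose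 difference factors through a projective module; its inverse shift is the syzygy operator $\Omega$, so that $\operatorname{Ext}^n_{\underline{\operatorname{CMP}}\,B}(X,Y)=\operatorname{Hom}_{\underline{\operatorname{CMP}}\,B}(\Omega^nX,Y)$. Let $M$ be an indecomposable non-projective syzygy in $\operatorname{mod}B$, that is, an indecomposable non-projective module that embeds into a finitely generated projective module, and let $P_1\to P_0\to M\to 0$ be a minimal projective presentation of $M$. Then, for every vertex $x$ of $Q$, the modules $M$ and $\operatorname{rad}P(x)$ belong to $\operatorname{CMP}B$, and (i) $\operatorname{Ext}^1_{\underline{\operatorname{CMP}}\,B}(M,\operatorname{rad}P(x))\neq 0$ if and only if $P(x)\in\operatorname{add}P_0$; (ii) $\operatorname{Ext}^2_{\underline{\operatorname{CMP}}\,B}(M,\operatorname{rad}P(x))\neq 0$ if and only if $P(x)\in\operatorname{add}P_1$. Here $\operatorname{add}P$ denotes the class of all finite direct sums of direct summands of $P$. -/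

import Mathlib

open CategoryTheory

universe u

noncomputable section

namespace DimerTree

/-! ### The path algebra of a finite quiver -/

section PathAlgebra

variable (k : Type u) [Field k] (V : Type u) [Quiver.{u} V]

/-- The paths of the quiver (including the stationary ones), with their end points. -/
abbrev AnyPath := Σ i j : V, Quiver.Path i j

/-- The path algebra `k Q`: the vector space with basis the set of all paths. -/
def PathAlgebra := AnyPath V →₀ k

namespace PathAlgebra

instance : AddCommGroup (PathAlgebra k V) := inferInstanceAs (AddCommGroup (AnyPath V →₀ k))

instance : Module k (PathAlgebra k V) := inferInstanceAs (Module k (AnyPath V →₀ k))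

/-- The basis of the path algebra that is given by the paths. -/
def basis : Module.Basis (AnyPath V) k (PathAlgebra k V) :=
  Module.Basis.ofRepr (LinearEquiv.refl k (AnyPath V →₀ k))

variable {V}

/-- The basis element given by a path. -/
def ofPath {i j : V} (p : Quiver.Path i j) : PathAlgebra k V := basis k V ⟨i, j, p⟩

open Classical in
/-- The product `p q` of two paths is the concatenation "first `p`, then `q`" if `p` ends where
`q` starts, and zero otherwise. -/
def basisMul (p q : AnyPath V) : PathAlgebra k V :=
  if h : p.2.1 = q.1 then ofPath k (p.2.2.comp (q.2.2.cast h.symm rfl)) else 0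

theorem basisMul_comp {i j l : V} (p : Quiver.Path i j) (q : Quiver.Path j l) :
    basisMul k ⟨i, j, p⟩ ⟨j, l, q⟩ = ofPath k (p.comp q) := by
  simp [basisMul]

theorem basisMul_of_ne {p q : AnyPath V} (h : p.2.1 ≠ q.1) : basisMul k p q = 0 := by
  simp [basisMul, h]

/-- The bilinear extension of the product of paths. -/
def mulHom : PathAlgebra k V →ₗ[k] PathAlgebra k V →ₗ[k] PathAlgebra k V :=
  (basis k V).constr k fun p => (basis k V).constr k (basisMul k p)

instance : Mul (PathAlgebra k V) := ⟨fun f g => mulHom k f g⟩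

theorem mul_def (f g : PathAlgebra k V) : f * g = mulHom k f g := rfl

theorem ofPath_mul_ofPath' {i j l m : V} (p : Quiver.Path i j) (q : Quiver.Path l m) :
    ofPath k p * ofPath k q = basisMul k ⟨i, j, p⟩ ⟨l, m, q⟩ := by
  rw [mul_def, mulHom, ofPath, ofPath, Module.Basis.constr_basis, Module.Basis.constr_basis]

theorem ofPath_mul_ofPath {i j l : V} (p : Quiver.Path i j) (q : Quiver.Path j l) :
    ofPath k p * ofPath k q = ofPath k (p.comp q) := by
  rw [ofPath_mul_ofPath', basisMul_comp]

theorem ofPath_mul_ofPath_of_ne {i j l m : V} (p : Quiver.Path i j) (q : Quiver.Path l m)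
    (h : j ≠ l) : ofPath k p * ofPath k q = 0 := by
  rw [ofPath_mul_ofPath', basisMul_of_ne]
  exact h

variable {k} in
/-- Two linear maps on the path algebra that agree on paths are equal. -/
theorem hom_ext {N : Type*} [AddCommMonoid N] [Module k N] {f g : PathAlgebra k V →ₗ[k] N}
    (h : ∀ (i j : V) (p : Quiver.Path i j), f (ofPath k p) = g (ofPath k p)) : f = g := by
  exact (basis k V).ext fun p => h p.1 p.2.1 p.2.2

theorem ofPath_assoc {a b c d e f : V} (p : Quiver.Path a b) (q : Quiver.Path c d)
    (r : Quiver.Path e f) :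
    ofPath k p * ofPath k q * ofPath k r = ofPath k p * (ofPath k q * ofPath k r) := by
  have zl (x : PathAlgebra k V) : 0 * x = 0 := by simp [mul_def]
  have zr (x : PathAlgebra k V) : x * 0 = 0 := by simp [mul_def]
  by_cases h₁ : b = c
  · subst h₁
    by_cases h₂ : d = e
    · subst h₂
      simp only [ofPath_mul_ofPath, Quiver.Path.comp_assoc]
    · rw [ofPath_mul_ofPath, ofPath_mul_ofPath_of_ne k _ _ h₂, ofPath_mul_ofPath_of_ne k _ _ h₂, zr]
  · rw [ofPath_mul_ofPath_of_ne k _ _ h₁, zl]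
    by_cases h₂ : d = e
    · subst h₂
      rw [ofPath_mul_ofPath, ofPath_mul_ofPath_of_ne k _ _ h₁]
    · rw [ofPath_mul_ofPath_of_ne k _ _ h₂, zr]

variable {k} in
protected theorem mul_assoc (x y z : PathAlgebra k V) : x * y * z = x * (y * z) := by
  let L : PathAlgebra k V →ₗ[k] PathAlgebra k V →ₗ[k] PathAlgebra k V →ₗ[k] PathAlgebra k V :=
    (mulHom k).compr₂ (mulHom k)
  let R : PathAlgebra k V →ₗ[k] PathAlgebra k V →ₗ[k] PathAlgebra k V →ₗ[k] PathAlgebra k V :=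
    LinearMap.mk₂ k (fun x y => mulHom k x ∘ₗ mulHom k y)
      (fun a b c => by ext; simp) (fun a b c => by ext; simp)
      (fun a b c => by ext; simp) (fun a b c => by ext; simp)
  have hLR : L = R := by
    refine hom_ext fun a b p => hom_ext fun c d q => hom_ext fun e f r => ?_
    exact ofPath_assoc k p q r
  exact LinearMap.congr_fun (LinearMap.congr_fun (LinearMap.congr_fun hLR x) y) z

variable [Fintype V]

/-- The unit is the sum of the stationary paths. -/
instance : One (PathAlgebra k V) := ⟨∑ i : V, ofPath k (Quiver.Path.nil : Quiver.Path i i)⟩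

theorem one_def :
    (1 : PathAlgebra k V) = ∑ i : V, ofPath k (Quiver.Path.nil : Quiver.Path i i) := rfl

theorem one_mul_ofPath {i j : V} (p : Quiver.Path i j) : 1 * ofPath k p = ofPath k p := by
  rw [one_def, mul_def, map_sum, LinearMap.sum_apply, Finset.sum_eq_single i]
  · exact (ofPath_mul_ofPath k _ _).trans (by rw [Quiver.Path.nil_comp])
  · intro b _ hb
    exact ofPath_mul_ofPath_of_ne k _ _ hb
  · simp

theorem ofPath_mul_one {i j : V} (p : Quiver.Path i j) : ofPath k p * 1 = ofPath k p := by
  rw [one_def, mul_def, map_sum, Finset.sum_eq_single j]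
  · exact (ofPath_mul_ofPath k _ _).trans (by rw [Quiver.Path.comp_nil])
  · intro b _ hb
    exact ofPath_mul_ofPath_of_ne k _ _ hb.symm
  · simp

variable {k} in
protected theorem one_mul (a : PathAlgebra k V) : 1 * a = a := by
  have h : mulHom k (1 : PathAlgebra k V) = LinearMap.id :=
    hom_ext fun _ _ p => one_mul_ofPath k p
  rw [mul_def, h, LinearMap.id_apply]

variable {k} in
protected theorem mul_one (a : PathAlgebra k V) : a * 1 = a := by
  have h : (mulHom k).flip (1 : PathAlgebra k V) = LinearMap.id :=
    hom_ext fun _ _ p => ofPath_mul_one k p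
  rw [mul_def, ← LinearMap.flip_apply, h, LinearMap.id_apply]

instance : Ring (PathAlgebra k V) where
  left_distrib a b c := by rw [mul_def, mul_def, mul_def, map_add]
  right_distrib a b c := by rw [mul_def, mul_def, mul_def, map_add, LinearMap.add_apply]
  zero_mul a := by rw [mul_def, map_zero, LinearMap.zero_apply]
  mul_zero a := by rw [mul_def, map_zero]
  mul_assoc := PathAlgebra.mul_assoc
  one_mul := PathAlgebra.one_mul
  mul_one := PathAlgebra.mul_one
  zsmul := (inferInstance : AddCommGroup (PathAlgebra k V)).zsmul
  zsmul_zero' := SubNegMonoid.zsmul_zero'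
  zsmul_succ' := SubNegMonoid.zsmul_succ'
  zsmul_neg' := SubNegMonoid.zsmul_neg'
  neg_add_cancel := neg_add_cancel
  sub_eq_add_neg := sub_eq_add_neg

instance : Algebra k (PathAlgebra k V) :=
  Algebra.ofModule
    (fun r x y => by rw [mul_def, mul_def, map_smul, LinearMap.smul_apply])
    (fun r x y => by rw [mul_def, mul_def, map_smul])

/-- The idempotent given by the stationary path at a vertex. -/
def vertex (i : V) : PathAlgebra k V := ofPath k (Quiver.Path.nil : Quiver.Path i i)

/-- The element given by an arrow. -/
def arrow (a : Quiver.Total V) : PathAlgebra k V := ofPath k a.hom.toPath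

end PathAlgebra

end PathAlgebra

/-! ### Potentials and Jacobian algebras -/

section Jacobian

variable (k : Type u) [Field k] (V : Type u) [Quiver.{u} V] [Fintype V]

/-- A potential: a formal linear combination of cyclic words in the arrows, up to rotation. -/
abbrev Potential := Cycle (Quiver.Total V) →₀ k

variable {V}

open Classical in
/-- The cyclic derivative of a cyclic path: each rotation `α p` that starts with the arrow `α`
contributes the path `p`, from the target of `α` to the source of `α`. -/
def cyclicDerivative (α : Quiver.Total V) (c : Cycle (Quiver.Total V)) : PathAlgebra k V :=
  (c.lists.map fun l => match l with
    | [] => 0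
    | a :: p => if a = α then
        PathAlgebra.vertex k α.right * (p.map (PathAlgebra.arrow k)).prod else 0).sum

variable {k}

/-- The cyclic derivative of a potential. -/
def Potential.derivative (W : Potential k V) (α : Quiver.Total V) : PathAlgebra k V :=
  W.sum fun c r => r • cyclicDerivative k α c

/-- The Jacobian algebra: the path algebra modulo the two-sided ideal that is generated by the
cyclic derivatives of the potential. -/
def JacobianAlgebra (W : Potential k V) :=
  RingQuot fun x y : PathAlgebra k V => ∃ α : Quiver.Total V, x = W.derivative α ∧ y = 0

variable (W : Potential k V)

instance : Ring (JacobianAlgebra W) :=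
  inferInstanceAs (Ring (RingQuot fun x y : PathAlgebra k V =>
    ∃ α : Quiver.Total V, x = W.derivative α ∧ y = 0))

instance : Algebra k (JacobianAlgebra W) :=
  inferInstanceAs (Algebra k (RingQuot fun x y : PathAlgebra k V =>
    ∃ α : Quiver.Total V, x = W.derivative α ∧ y = 0))

/-- The quotient map from the path algebra to the Jacobian algebra. -/
def JacobianAlgebra.mk : PathAlgebra k V →ₐ[k] JacobianAlgebra W :=
  RingQuot.mkAlgHom k fun x y : PathAlgebra k V =>
    ∃ α : Quiver.Total V, x = W.derivative α ∧ y = 0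

instance [Module.Finite k (JacobianAlgebra W)] : IsNoetherianRing (JacobianAlgebra W)ᵐᵒᵖ :=
  isNoetherian_of_tower k inferInstance

/-- The right module `P(x) = e_x B`. Right `B`-modules are modules over `Bᵐᵒᵖ`. -/
def JacobianAlgebra.P (x : V) : Submodule (JacobianAlgebra W)ᵐᵒᵖ (JacobianAlgebra W) :=
  Submodule.span _ {JacobianAlgebra.mk W (PathAlgebra.vertex k x)}

end Jacobian

/-! ### Dimer tree quivers and dimer tree algebras -/

section Quivers

variable (V : Type u) [Quiver.{u} V]

/-- A chordless cycle, up to rotation: a nonempty cyclic path without repeated vertices such that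
the full subquiver on its vertices has no other arrows. -/
structure ChordlessCycle where
  /-- The arrows of the cycle, in cyclic order. -/
  cycle : Cycle (Quiver.Total V)
  ne_nil : cycle ≠ Cycle.nil
  chain : cycle.Chain fun a b => a.right = b.left
  nodup : (cycle.map Quiver.Total.left).Nodup
  full : ∀ a : Quiver.Total V, a.left ∈ cycle.map Quiver.Total.left →
    a.right ∈ cycle.map Quiver.Total.left → a ∈ cycle

variable {V}

/-- A boundary arrow lies in exactly one chordless cycle. -/
def IsBoundaryArrow (a : Quiver.Total V) : Prop := ∃! C : ChordlessCycle V, a ∈ C.cycle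

variable (V)

/-- The dual graph. Its vertices are the chordless cycles and the boundary arrows. Two chordless
cycles are joined if they share an arrow, and a chordless cycle is joined to each of its boundary
arrows. -/
def dualGraph : SimpleGraph (ChordlessCycle V ⊕ {a : Quiver.Total V // IsBoundaryArrow a}) :=
  SimpleGraph.fromRel fun v w => match v, w with
    | Sum.inl C, Sum.inl C' => ∃ a, a ∈ C.cycle ∧ a ∈ C'.cycle
    | Sum.inl C, Sum.inr a => a.1 ∈ C.cycle
    | Sum.inr _, _ => False

/-- The conditions on the quiver of a dimer tree algebra (which is also finite). The dual graph has
one edge between two distinct chordless cycles for each arrow they share, so that it is a tree if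
it is one after double edges are replaced by single ones and there are no double edges. -/
structure IsDimerTreeQuiver : Prop where
  connected : (SimpleGraph.fromRel fun v w : V => Nonempty (v ⟶ w)).Connected
  no_loops : ∀ v : V, IsEmpty (v ⟶ v)
  no_two_cycles : ∀ v w : V, Nonempty (v ⟶ w) → IsEmpty (w ⟶ v)
  mem_cycle : ∀ a : Quiver.Total V, ∃ C : ChordlessCycle V, a ∈ C.cycle
  isTree : (dualGraph V).IsTree
  no_double_edges : ∀ C C' : ChordlessCycle V, C ≠ C' → ∀ a b : Quiver.Total V,
    a ∈ C.cycle → a ∈ C'.cycle → b ∈ C.cycle → b ∈ C'.cycle → a = b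

section Finiteness

variable [Finite V] [∀ v w : V, Finite (v ⟶ w)]

instance : Finite (Quiver.Total V) :=
  Finite.of_injective (β := Σ v w : V, (v ⟶ w)) (fun a => ⟨a.left, a.right, a.hom⟩) (by
    rintro ⟨a, b, f⟩ ⟨c, d, g⟩ h
    obtain ⟨rfl, h⟩ := Sigma.mk.inj_iff.mp h
    obtain ⟨rfl, h⟩ := Sigma.mk.inj_iff.mp (eq_of_heq h)
    obtain rfl := eq_of_heq h
    rfl)

instance : Finite (ChordlessCycle V) := by
  classical
  have := Fintype.ofFinite (Quiver.Total V)
  refine Finite.of_injective (β := {s : Cycle (Quiver.Total V) // s.Nodup})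
    (fun C => ⟨C.cycle, ?_⟩) ?_
  · have h := C.nodup
    generalize C.cycle = c at h
    induction c using Quotient.inductionOn' with
    | h l => exact List.Nodup.of_map _ h
  · rintro ⟨c, _⟩ ⟨d, _⟩ h
    simpa using h

instance : Fintype (ChordlessCycle V) := Fintype.ofFinite _

end Finiteness

variable {V} [Fintype V] [∀ v w : V, Finite (v ⟶ w)] (k : Type u) [Field k]

/-- The potential `∑ (-1) ^ d(C) C` over all chordless cycles, where `d(C)` is the distance from a
base cycle `C₀` to `C` in the dual graph. -/
def dimerPotential (C₀ : ChordlessCycle V) : Potential k V :=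
  ∑ C : ChordlessCycle V,
    Finsupp.single C.cycle ((-1 : k) ^ (dualGraph V).dist (Sum.inl C₀) (Sum.inl C))

/-- The algebra `B = Jac(Q, W)` of a quiver `Q` with the potential above. -/
abbrev DimerTreeAlgebra (C₀ : ChordlessCycle V) := JacobianAlgebra (dimerPotential k C₀)

end Quivers

/-! ### Modules: syzygies, minimal presentations, the stable category -/

section Modules

variable {R : Type u} [Ring R]

/-- Indecomposable modules. -/
def IsIndecomposable (R : Type u) [Ring R] (M : Type u) [AddCommGroup M] [Module R M] : Prop :=
  Nontrivial M ∧ ∀ N N' : Submodule R M, IsCompl N N' → N = ⊥ ∨ N' = ⊥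

/-- Syzygies: submodules of finitely generated projective modules. -/
def IsSyzygy (R : Type u) [Ring R] (M : Type u) [AddCommGroup M] [Module R M] : Prop :=
  ∃ (P : Type u) (_ : AddCommGroup P) (_ : Module R P), Module.Finite R P ∧
    Module.Projective R P ∧ ∃ f : M →ₗ[R] P, Function.Injective f

/-- A projective cover: a surjection from a projective module with superfluous kernel. -/
structure IsProjectiveCover {P M : Type u} [AddCommGroup P] [Module R P] [AddCommGroup M]
    [Module R M] (f : P →ₗ[R] M) : Prop where
  projective : Module.Projective R P
  surjective : Function.Surjective f
  superfluous : ∀ N : Submodule R P, N ⊔ LinearMap.ker f = ⊤ → N = ⊤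

/-- `P₁ → P₀ → M → 0` is a minimal projective presentation: `P₀ → M` is a projective cover of `M`
and `P₁ → P₀` is a projective cover of the kernel of `P₀ → M`. -/
structure IsMinimalPresentation {P₁ P₀ M : Type u} [AddCommGroup P₁] [Module R P₁]
    [AddCommGroup P₀] [Module R P₀] [AddCommGroup M] [Module R M]
    (d₁ : P₁ →ₗ[R] P₀) (d₀ : P₀ →ₗ[R] M) : Prop where
  exact : LinearMap.range d₁ = LinearMap.ker d₀
  cover₀ : IsProjectiveCover d₀
  cover₁ : IsProjectiveCover d₁.rangeRestrict

/-- `X ∈ add P`: the module `X` is a finite direct sum of direct summands of `P`. -/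
def InAdd (R : Type u) [Ring R] (X P : Type u) [AddCommGroup X] [Module R X] [AddCommGroup P]
    [Module R P] : Prop :=
  ∃ (n : ℕ) (S : Fin n → Submodule R P), (∀ i, ∃ T, IsCompl (S i) T) ∧
    Nonempty (X ≃ₗ[R] ((i : Fin n) → S i))

/-- Projectively Cohen-Macaulay modules: finitely generated modules `M` with `Ext^i(M, R) = 0` for
all `i > 0`. -/
def IsCMP (R : Type u) [Ring R] : ObjectProperty (ModuleCat.{u} R) := fun M =>
  Module.Finite R M ∧ ∀ i : ℕ, 0 < i → Subsingleton (Abelian.Ext M (ModuleCat.of R R) i)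

/-- The category `CMP`, a full subcategory of the category of modules. -/
abbrev CMP (R : Type u) [Ring R] := (IsCMP R).FullSubcategory

/-- Two morphisms in `CMP` are identified in the stable category if their difference factors
through a projective module in `CMP`. -/
def stableRel (R : Type u) [Ring R] : HomRel (CMP R) := fun X Y f g =>
  ∃ (P : CMP R) (a : X ⟶ P) (b : P ⟶ Y), Module.Projective R P.obj ∧ f - g = a ≫ b

/-- The direct sum of two modules in `CMP` is again in `CMP`. -/
theorem isCMP_prod {M N : ModuleCat.{u} R} (hM : IsCMP R M) (hN : IsCMP R N) :
    IsCMP R (M ⊞ N) := by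
  refine ⟨?_, fun i hi => ?_⟩
  · have := hM.1
    have := hN.1
    exact Module.Finite.equiv (ModuleCat.biprodIsoProd M N).toLinearEquiv.symm
  · have := hM.2 i hi
    have := hN.2 i hi
    refine ⟨fun x y => Abelian.Ext.biprod_ext ?_ ?_⟩ <;> exact Subsingleton.elim _ _

theorem stableRel_add {X Y : CMP R} {f₁ f₂ g₁ g₂ : X ⟶ Y} (h₁ : stableRel R f₁ f₂)
    (h₂ : stableRel R g₁ g₂) : stableRel R (f₁ + g₁) (f₂ + g₂) := by
  obtain ⟨P, a, b, hP, hf⟩ := h₁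
  obtain ⟨Q, c, d, hQ, hg⟩ := h₂
  refine ⟨⟨P.obj ⊞ Q.obj, isCMP_prod P.property Q.property⟩,
    ⟨Limits.biprod.lift a.hom c.hom⟩, ⟨Limits.biprod.desc b.hom d.hom⟩, ?_, ?_⟩
  · exact Module.Projective.of_equiv (ModuleCat.biprodIsoProd P.obj Q.obj).toLinearEquiv.symm
  · rw [add_sub_add_comm, hf, hg]
    ext1
    exact (Limits.biprod.lift_desc ..).symm

theorem isCMP_zero : IsCMP R (ModuleCat.of R PUnit.{u + 1}) := by
  refine ⟨inferInstance, fun i hi => ⟨fun x y => ?_⟩⟩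
  obtain ⟨i, rfl⟩ := Nat.exists_eq_succ_of_ne_zero hi.ne'
  have : Projective (ModuleCat.of R PUnit.{u + 1}) :=
    (IsProjective.iff_projective _).mp inferInstance
  rw [x.eq_zero_of_projective, y.eq_zero_of_projective]

instance : Congruence (stableRel R) where
  equivalence := by
    refine ⟨fun f => ⟨⟨_, isCMP_zero⟩, 0, 0, ?_, by simp⟩, ?_, ?_⟩
    · exact inferInstanceAs (Module.Projective R PUnit.{u + 1})
    · rintro f g ⟨P, a, b, hP, h⟩
      exact ⟨P, a, -b, hP, by rw [Preadditive.comp_neg, ← h, neg_sub]⟩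
    · rintro f g h h₁ h₂
      obtain ⟨P, a, b, hP, e⟩ := stableRel_add h₁ h₂
      exact ⟨P, a, b, hP, by rw [← e]; abel⟩
  comp_left := by
    rintro X Y Z f g g' ⟨P, a, b, hP, h⟩
    exact ⟨P, f ≫ a, b, hP, by rw [← Preadditive.comp_sub, h, Category.assoc]⟩
  comp_right := by
    rintro X Y Z f f' g ⟨P, a, b, hP, h⟩
    exact ⟨P, a, b ≫ g, hP, by rw [← Preadditive.sub_comp, h, Category.assoc]⟩

/-- The stable category of `CMP`. -/
abbrev StableCMP (R : Type u) [Ring R] := CategoryTheory.Quotient (stableRel R)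

instance : Preadditive (StableCMP R) :=
  CategoryTheory.Quotient.preadditive _ fun _ _ _ _ _ _ => stableRel_add

/-- The object of the stable category given by a module in `CMP`. -/
abbrev toStable (X : CMP R) : StableCMP R := (CategoryTheory.Quotient.functor (stableRel R)).obj X

/-- The kernel of a surjection from a finitely generated free module to `X`. -/
def syzygyModule (X : CMP R) : ModuleCat.{u} R :=
  haveI := X.property.1
  ModuleCat.of R (LinearMap.ker (Module.Finite.exists_fin' R X.obj).choose_spec.choose)

theorem isCMP_syzygyModule [IsNoetherianRing R] (X : CMP R) : IsCMP R (syzygyModule X) := by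
  have := X.property.1
  let f := (Module.Finite.exists_fin' R X.obj).choose_spec.choose
  have hf : Function.Surjective f := (Module.Finite.exists_fin' R X.obj).choose_spec.choose_spec
  refine ⟨inferInstanceAs (Module.Finite R (LinearMap.ker f)), fun i hi => ?_⟩
  let S : ShortComplex (ModuleCat.{u} R) :=
    ShortComplex.mk (ModuleCat.ofHom (LinearMap.ker f).subtype) (ModuleCat.ofHom f)
      (by ext x; exact x.2)
  have hS : S.ShortExact :=
    { exact := by
        rw [ShortComplex.moduleCat_exact_iff]
        intro x hx
        exact ⟨⟨x, hx⟩, rfl⟩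
      mono_f := (ModuleCat.mono_iff_injective _).mpr (Submodule.subtype_injective _)
      epi_g := (ModuleCat.epi_iff_surjective _).mpr hf }
  have : Projective S.X₂ := (IsProjective.iff_projective _).mp inferInstance
  refine subsingleton_of_forall_eq 0 fun x => ?_
  have := X.property.2 (1 + i) (by omega)
  obtain ⟨y, rfl⟩ := Abelian.Ext.contravariant_sequence_exact₁ hS _ x rfl
    (Subsingleton.elim (α := Abelian.Ext X.obj (ModuleCat.of R R) (1 + i)) _ _)
  obtain ⟨i, rfl⟩ := Nat.exists_eq_succ_of_ne_zero hi.ne'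
  rw [y.eq_zero_of_projective, Abelian.Ext.comp_zero]
  rfl

/-- The syzygy operator `Ω` on `CMP`. Up to isomorphism in the stable category, `Ω X` is
independent of the chosen projective module. -/
def syzygy [IsNoetherianRing R] (X : CMP R) : CMP R := ⟨syzygyModule X, isCMP_syzygyModule X⟩

/-- `Ext^n(X, Y) = Hom(X, Y[n]) = Hom(X[-n], Y)` in the stable category, whose inverse shift is
the syzygy operator `Ω`. -/
abbrev StableExt [IsNoetherianRing R] (n : ℕ) (X Y : CMP R) : Type u :=
  toStable (syzygy^[n] X) ⟶ toStable Y

end Modules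

end DimerTree

end

open DimerTree

noncomputable section

set_option linter.unusedSectionVars false

namespace DimerTree

/-! Let J be the radical of P = P(x). It contains every proper submodule of P, and P/J is simple.
The theorem reduces to counting maps into P/J.

A stable map ΩX → J is zero exactly when it extends to the free module around ΩX. As Ext¹(X, B) = 0,
all such maps extend if and only if every map X → P/J lifts to P
(`exists_stableExt_one_ne_zero_iff_not_liftsAlong`). A nonzero map from X = M never lifts, since its
lift would be onto P and would split. A nonzero map from the minimal syzygy X = ker(P₀ → M) never
lifts either: the lift would extend to P₀ because Ext¹(M, B) = 0, and maps from P₀ to a simple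
module kill the superfluous kernel. So Ext¹ and Ext² are nonzero exactly when M, respectively its
minimal syzygy, maps nontrivially to P/J, that is, when P is a summand of the projective cover P₀,
respectively P₁.

Two facts about B are needed. First, Ext²(-, B) = 0, so that syzygies lie in CMP. Composition series
reduce this to simple modules, and dimension shifting to Ext¹(rad P(x), B) = 0. The arrows starting
at x generate rad P(x), and the second derivatives of W generate their relations. A map from these
relations to B has values b_β with ∑ b_β β = 0. By the left-right mirror image of the same
description, b is a left combination of second derivatives, and its coefficients define the
extension (`exists_extension_arrowMap`). The symmetry of second derivatives makes the two sides
match.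

Second, the arrow ideal must be nilpotent, so that P(x) is local with the expected radical. The tree
shape of the dual graph yields positive weights of the arrows for which every chordless cycle has
weight one (`exists_weight`). The weight of paths then grades B. A finite-dimensional B has only
finitely many weights, so long paths vanish (`exists_mk_ofPath_eq_zero`). -/

/-! ### Extensions and maps on kernels -/

section KernelExtension

variable {R : Type u} [Ring R] {A B C : Type u} [AddCommGroup A] [Module R A] [AddCommGroup B]
  [Module R B] [AddCommGroup C] [Module R C]

/-- A short exact sequence of modules as a short complex. -/
abbrev moduleShortComplex (f : A →ₗ[R] B) (g : B →ₗ[R] C)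
    (h : LinearMap.range f = LinearMap.ker g) : ShortComplex (ModuleCat.{u} R) :=
  ShortComplex.mk (ModuleCat.ofHom f) (ModuleCat.ofHom g) (by
    ext x
    exact h.le ⟨x, rfl⟩)

theorem moduleShortComplex_shortExact {f : A →ₗ[R] B} {g : B →ₗ[R] C}
    (h : LinearMap.range f = LinearMap.ker g) (hf : Function.Injective f)
    (hg : Function.Surjective g) : (moduleShortComplex f g h).ShortExact where
  exact := by
    rw [ShortComplex.moduleCat_exact_iff]
    exact fun x hx => h.ge hx
  mono_f := (ModuleCat.mono_iff_injective _).mpr hf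
  epi_g := (ModuleCat.epi_iff_surjective _).mpr hg

/-- If `Ext¹(C, Y) = 0` and `A → B → C` is short exact, maps `A → Y` extend to `B`. -/
theorem exists_extension_of_ext_one {f : A →ₗ[R] B} {g : B →ₗ[R] C}
    (h : LinearMap.range f = LinearMap.ker g) (hf : Function.Injective f)
    (hg : Function.Surjective g) {Y : Type u} [AddCommGroup Y] [Module R Y]
    [Subsingleton (Abelian.Ext (ModuleCat.of R C) (ModuleCat.of R Y) 1)] (φ : A →ₗ[R] Y) :
    ∃ ψ : B →ₗ[R] Y, ψ ∘ₗ f = φ := by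
  have hS := moduleShortComplex_shortExact h hf hg
  obtain ⟨y, hy⟩ := Abelian.Ext.contravariant_sequence_exact₁ hS (ModuleCat.of R Y)
    (Abelian.Ext.mk₀ (ModuleCat.ofHom φ)) (n₁ := 1) rfl
    (Subsingleton.elim (α := Abelian.Ext (ModuleCat.of R C) (ModuleCat.of R Y) 1) _ _)
  obtain ⟨ψ, rfl⟩ := (Abelian.Ext.mk₀_bijective _ _).2 y
  rw [Abelian.Ext.mk₀_comp_mk₀] at hy
  have := (Abelian.Ext.mk₀_bijective _ _).1 hy
  exact ⟨ψ.hom, congrArg ModuleCat.Hom.hom this⟩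

/-- Dimension shifting: `Ext^{n+1}(C, Y) = 0` if `Ext^n(A, Y) = 0` and the middle term of
`A → B → C` is projective. -/
theorem subsingleton_ext_succ {f : A →ₗ[R] B} {g : B →ₗ[R] C}
    (h : LinearMap.range f = LinearMap.ker g) (hf : Function.Injective f)
    (hg : Function.Surjective g) [Module.Projective R B] {Y : ModuleCat.{u} R} {n : ℕ}
    [Subsingleton (Abelian.Ext (ModuleCat.of R A) Y n)] :
    Subsingleton (Abelian.Ext (ModuleCat.of R C) Y (n + 1)) := by
  have hS := moduleShortComplex_shortExact h hf hg
  have : Projective (ModuleCat.of R B) := (IsProjective.iff_projective _).mp inferInstance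
  refine subsingleton_of_forall_eq 0 fun x => ?_
  obtain ⟨y, rfl⟩ := Abelian.Ext.contravariant_sequence_exact₃ hS _ x
    (Abelian.Ext.eq_zero_of_projective (P := ModuleCat.of R B) _) (n₀ := n) (by omega)
  rw [Subsingleton.elim (α := Abelian.Ext (ModuleCat.of R A) Y n) y 0, Abelian.Ext.comp_zero]

/-- Dimension shifting: `Ext^n(A, Y) = 0` for `n > 0` if `Ext^{n+1}(C, Y) = 0` and the middle term
of `A → B → C` is projective. -/
theorem subsingleton_ext_of_succ {f : A →ₗ[R] B} {g : B →ₗ[R] C}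
    (h : LinearMap.range f = LinearMap.ker g) (hf : Function.Injective f)
    (hg : Function.Surjective g) [Module.Projective R B] {Y : ModuleCat.{u} R} {n : ℕ}
    [Subsingleton (Abelian.Ext (ModuleCat.of R C) Y (n + 2))] :
    Subsingleton (Abelian.Ext (ModuleCat.of R A) Y (n + 1)) := by
  have hS := moduleShortComplex_shortExact h hf hg
  have : Projective (ModuleCat.of R B) := (IsProjective.iff_projective _).mp inferInstance
  refine subsingleton_of_forall_eq 0 fun x => ?_
  obtain ⟨y, rfl⟩ := Abelian.Ext.contravariant_sequence_exact₁ hS _ x (n₁ := n + 2) (by omega)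
    (Subsingleton.elim (α := Abelian.Ext (ModuleCat.of R C) Y (n + 2)) _ _)
  rw [Abelian.Ext.eq_zero_of_projective (P := ModuleCat.of R B) (y : Abelian.Ext _ _ (n + 1)),
    Abelian.Ext.comp_zero]

/-- If maps `A → Y` extend to the projective module `B`, then `Ext¹(C, Y) = 0`. -/
theorem subsingleton_ext_one {f : A →ₗ[R] B} {g : B →ₗ[R] C}
    (h : LinearMap.range f = LinearMap.ker g) (hf : Function.Injective f)
    (hg : Function.Surjective g) [Module.Projective R B] {Y : Type u} [AddCommGroup Y] [Module R Y]
    (hext : ∀ φ : A →ₗ[R] Y, ∃ ψ : B →ₗ[R] Y, ψ ∘ₗ f = φ) :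
    Subsingleton (Abelian.Ext (ModuleCat.of R C) (ModuleCat.of R Y) 1) := by
  have hS := moduleShortComplex_shortExact h hf hg
  have : Projective (ModuleCat.of R B) := (IsProjective.iff_projective _).mp inferInstance
  refine subsingleton_of_forall_eq 0 fun x => ?_
  obtain ⟨y, rfl⟩ := Abelian.Ext.contravariant_sequence_exact₃ hS _ x
    (Abelian.Ext.eq_zero_of_projective (P := ModuleCat.of R B) (n := 0) _) (n₀ := 0) (by omega)
  obtain ⟨φ, rfl⟩ := (Abelian.Ext.mk₀_bijective _ _).2 y
  obtain ⟨ψ, hψ⟩ := hext φ.hom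
  have : φ = (moduleShortComplex f g h).f ≫ ModuleCat.ofHom ψ := by
    ext a
    exact (LinearMap.congr_fun hψ a).symm
  rw [this, ← Abelian.Ext.mk₀_comp_mk₀]
  exact hS.extClass_comp_assoc _

/-- The modules `A` with `Ext¹(A, R) = 0` also satisfy `Ext¹(A, Q) = 0` for finitely generated
projective modules `Q`. -/
theorem exists_extension_to_projective {f : A →ₗ[R] B} {g : B →ₗ[R] C}
    (h : LinearMap.range f = LinearMap.ker g) (hf : Function.Injective f)
    (hg : Function.Surjective g)
    [Subsingleton (Abelian.Ext (ModuleCat.of R C) (ModuleCat.of R R) 1)]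
    {Q : Type u} [AddCommGroup Q] [Module R Q] [Module.Finite R Q] [Module.Projective R Q]
    (φ : A →ₗ[R] Q) : ∃ ψ : B →ₗ[R] Q, ψ ∘ₗ f = φ := by
  -- `Q` is a summand of a finite free module via `s` and `p`: extend each coordinate of `s ∘ φ`,
  -- then project back.
  obtain ⟨n, p, hp⟩ := Module.Finite.exists_fin' R Q
  obtain ⟨s, hs⟩ := Module.projective_lifting_property p LinearMap.id hp
  choose ψ hψ using fun i : Fin n =>
    exists_extension_of_ext_one h hf hg (LinearMap.proj i ∘ₗ s ∘ₗ φ)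
  refine ⟨p ∘ₗ LinearMap.pi ψ, ?_⟩
  rw [LinearMap.comp_assoc]
  have : LinearMap.pi ψ ∘ₗ f = s ∘ₗ φ := by
    ext a i
    exact LinearMap.congr_fun (hψ i) a
  rw [this, ← LinearMap.comp_assoc, hs, LinearMap.id_comp]

/-- A finitely generated projective module is in `CMP`. -/
theorem isCMP_of_projective (Q : ModuleCat.{u} R) [Module.Finite R Q] [Module.Projective R Q] :
    IsCMP R Q := by
  refine ⟨inferInstance, fun i hi => ?_⟩
  obtain ⟨i, rfl⟩ := Nat.exists_eq_succ_of_ne_zero hi.ne'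
  have : Projective Q := (IsProjective.iff_projective _).mp inferInstance
  exact subsingleton_of_forall_eq 0 fun x => x.eq_zero_of_projective

/-- If `Ext²(-, R)` vanishes on finitely generated modules, then syzygies are in `CMP`. -/
theorem IsSyzygy.isCMP [IsNoetherianRing R]
    (hR : ∀ (N : Type u) [AddCommGroup N] [Module R N] [Module.Finite R N],
      Subsingleton (Abelian.Ext (ModuleCat.of R N) (ModuleCat.of R R) 2))
    [Module.Finite R A] (hA : IsSyzygy R A) : IsCMP R (ModuleCat.of R A) := by
  have hR' (i : ℕ) : ∀ (N : Type u) [AddCommGroup N] [Module R N] [Module.Finite R N],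
      Subsingleton (Abelian.Ext (ModuleCat.of R N) (ModuleCat.of R R) (i + 2)) := by
    induction i with
    | zero => exact hR
    | succ i ih =>
      intro N _ _ _
      obtain ⟨n, f, hf⟩ := Module.Finite.exists_fin' R N
      have := ih (LinearMap.ker f)
      exact subsingleton_ext_succ (f := (LinearMap.ker f).subtype) (Submodule.range_subtype _)
        (Submodule.subtype_injective _) hf
  refine ⟨‹_›, fun i hi => ?_⟩
  obtain ⟨i, rfl⟩ := Nat.exists_eq_succ_of_ne_zero hi.ne'
  obtain ⟨P, _, _, _, _, f, hf⟩ := hA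
  -- The module is the kernel of the projection from `P` to this cokernel, so its Ext in degree `i +
  -- 1` is controlled by that of the cokernel in degree `i + 2`.
  have := hR' i (P ⧸ LinearMap.range f)
  exact subsingleton_ext_of_succ (f := f) (Submodule.ker_mkQ _).symm hf
    (Submodule.mkQ_surjective _)

end KernelExtension

/-! ### Lifting maps to a quotient of a projective module -/

section Lifting

variable {R : Type u} [Ring R]

/-- Every map from `X` to `S` lifts along `π : P → S`. -/
def LiftsAlong (X : Type u) [AddCommGroup X] [Module R X] {P S : Type u} [AddCommGroup P]
    [Module R P] [AddCommGroup S] [Module R S] (π : P →ₗ[R] S) : Prop :=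
  ∀ h : X →ₗ[R] S, ∃ l : X →ₗ[R] P, π ∘ₗ l = h

/-- The kernel of the chosen surjection from a free module to `X` is `syzygy X`. -/
def freeCover (X : CMP R) :
    haveI := X.property.1
    (Fin (Module.Finite.exists_fin' R X.obj).choose → R) →ₗ[R] X.obj :=
  haveI := X.property.1
  (Module.Finite.exists_fin' R X.obj).choose_spec.choose

theorem freeCover_surjective (X : CMP R) : Function.Surjective (freeCover X) :=
  haveI := X.property.1
  (Module.Finite.exists_fin' R X.obj).choose_spec.choose_spec

/-- If a map ΩX → Y factors through a projective module in CMP, its first factor extends to the free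
cover because Ext¹(X, R) = 0. Conversely, an extension is itself a factorization through the free
cover. -/
theorem exists_stableExt_one_ne_zero_iff [IsNoetherianRing R] {X Y : CMP R} :
    (∃ f : StableExt 1 X Y, f ≠ 0) ↔
      ∃ g : LinearMap.ker (freeCover X) →ₗ[R] Y.obj,
        ¬ ∃ g', g' ∘ₗ (LinearMap.ker (freeCover X)).subtype = g := by
  have key (g : syzygy X ⟶ Y) : (Quotient.functor (stableRel R)).map g = 0 ↔
      ∃ g', g' ∘ₗ (LinearMap.ker (freeCover X)).subtype = g.hom.hom := by
    rw [show (0 : (Quotient.functor (stableRel R)).obj (syzygy X) ⟶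
      (Quotient.functor (stableRel R)).obj Y) = (Quotient.functor (stableRel R)).map 0 from rfl,
      Quotient.functor_map_eq_iff]
    constructor
    · rintro ⟨Q, a, b, hQ, h⟩
      have := Q.property.1
      have : Subsingleton (Abelian.Ext (ModuleCat.of R X.obj) (ModuleCat.of R R) 1) :=
        X.property.2 1 one_pos
      obtain ⟨a', ha'⟩ := exists_extension_to_projective
        (f := (LinearMap.ker (freeCover X)).subtype) (g := freeCover X)
        (Submodule.range_subtype _) (Submodule.subtype_injective _) (freeCover_surjective X)
        (Q := Q.obj) a.hom.hom
      refine ⟨b.hom.hom ∘ₗ a', ?_⟩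
      rw [LinearMap.comp_assoc, ha']
      rw [sub_zero] at h
      rw [h]
      rfl
    · rintro ⟨g', hg'⟩
      refine ⟨⟨ModuleCat.of R _, isCMP_of_projective _⟩,
        ⟨ModuleCat.ofHom (LinearMap.ker (freeCover X)).subtype⟩, ⟨ModuleCat.ofHom g'⟩,
        inferInstanceAs (Module.Projective R (Fin _ → R)), ?_⟩
      rw [sub_zero]
      ext : 2
      exact hg'.symm
  constructor
  · rintro ⟨f, hf⟩
    obtain ⟨g, rfl⟩ := (Quotient.functor (stableRel R)).map_surjective f
    exact ⟨g.hom.hom, fun h => hf ((key g).2 h)⟩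
  · rintro ⟨g, hg⟩
    exact ⟨(Quotient.functor (stableRel R)).map (⟨ModuleCat.ofHom g⟩ : syzygy X ⟶ Y),
      fun h => hg ((key _).1 h)⟩

/-! ### Maps to the top of a projective module -/

variable {P : Type u} [AddCommGroup P] [Module R P]

variable {S : Type u} [AddCommGroup S] [Module R S]
  {M F F' : Type u} [AddCommGroup M] [Module R M] [AddCommGroup F] [Module R F]
  [AddCommGroup F'] [Module R F']

/-- A map that vanishes on the kernel of a surjection factors through it. -/
theorem exists_comp_eq_of_ker_le {d : F →ₗ[R] M} (hd : Function.Surjective d) {m : F →ₗ[R] S}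
    (h : LinearMap.ker d ≤ LinearMap.ker m) : ∃ l : M →ₗ[R] S, l ∘ₗ d = m := by
  refine ⟨(LinearMap.ker d).liftQ m h ∘ₗ (d.quotKerEquivOfSurjective hd).symm.toLinearMap,
    LinearMap.ext fun c => ?_⟩
  have : (d.quotKerEquivOfSurjective hd).symm (d c) = (LinearMap.ker d).mkQ c := by
    rw [LinearEquiv.symm_apply_eq]
    rfl
  simp [this]

/-- For a submodule `J` of a projective module `P` and a module `M` with `Ext¹(M, R) = 0`, maps
from a syzygy of `M` to `J` all extend if and only if maps from `M` to `P / J` all lift to `P`. -/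
theorem forall_extends_iff_liftsAlong [Module.Finite R P] [Module.Projective R P]
    [Module.Projective R F] [Subsingleton (Abelian.Ext (ModuleCat.of R M) (ModuleCat.of R R) 1)]
    {p : F →ₗ[R] M} (hs : Function.Surjective p) (J : Submodule R P) :
    (∀ g : LinearMap.ker p →ₗ[R] J, ∃ g', g' ∘ₗ (LinearMap.ker p).subtype = g) ↔
      LiftsAlong M J.mkQ := by
  constructor
  · intro H h
    -- The lift `l` on `F` maps the kernel of `p` into `J`. Subtracting an extension `g'` of that
    -- restriction, with values in `J`, makes `l` descend to `M` without changing it modulo `J`.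
    obtain ⟨l, hl⟩ := Module.projective_lifting_property J.mkQ (h ∘ₗ p) J.mkQ_surjective
    have hlJ (c : LinearMap.ker p) : l c ∈ J := by
      rw [← Submodule.Quotient.mk_eq_zero, ← Submodule.mkQ_apply, ← LinearMap.comp_apply, hl,
        LinearMap.comp_apply, c.2, map_zero]
    obtain ⟨g', hg'⟩ := H ((l ∘ₗ (LinearMap.ker p).subtype).codRestrict J hlJ)
    have hm : LinearMap.ker p ≤ LinearMap.ker (l - J.subtype ∘ₗ g') := fun c hc =>
      sub_eq_zero.2 (congrArg J.subtype (LinearMap.congr_fun hg' ⟨c, hc⟩)).symm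
    obtain ⟨l', hl'⟩ := exists_comp_eq_of_ker_le hs hm
    refine ⟨l', LinearMap.ext fun c => ?_⟩
    obtain ⟨c, rfl⟩ := hs c
    have h1 := LinearMap.congr_fun hl' c
    have h2 := LinearMap.congr_fun hl c
    simp only [LinearMap.comp_apply] at h1 h2 ⊢
    rw [h1, ← h2]
    simp
  · intro H g
    -- `g` always extends with values in `P`. Modulo `J` the extension `G` descends to `M`, and a
    -- lift of the descended map is the correction that moves `G` into `J`.
    obtain ⟨G, hG⟩ := exists_extension_to_projective (f := (LinearMap.ker p).subtype)
      (Submodule.range_subtype _) (Submodule.subtype_injective _) hs (J.subtype ∘ₗ g)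
    have hG' (c) : G (c : LinearMap.ker p) = g c := LinearMap.congr_fun hG c
    obtain ⟨h, hh⟩ := exists_comp_eq_of_ker_le (m := J.mkQ ∘ₗ G) hs fun c hc => by
      simp [hG' ⟨c, hc⟩]
    obtain ⟨l, rfl⟩ := H h
    have hlG (c) : (G - l ∘ₗ p) c ∈ J := by
      have h1 := LinearMap.congr_fun hh c
      simp only [LinearMap.comp_apply] at h1
      rw [← Submodule.Quotient.mk_eq_zero, ← Submodule.mkQ_apply, LinearMap.sub_apply, map_sub,
        ← h1, LinearMap.comp_apply, sub_self]
    refine ⟨(G - l ∘ₗ p).codRestrict J hlG, LinearMap.ext fun c => Subtype.ext ?_⟩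
    simp [hG']

/-- `Ext¹(X, J)` in the stable category detects the maps from `X` to `P / J` that do not lift
to `P`. -/
theorem exists_stableExt_one_ne_zero_iff_not_liftsAlong [IsNoetherianRing R] [Module.Finite R P]
    [Module.Projective R P] (X : CMP R) (J : Submodule R P) (hJ : IsCMP R (ModuleCat.of R J)) :
    (∃ f : StableExt 1 X ⟨_, hJ⟩, f ≠ 0) ↔ ¬ LiftsAlong X.obj J.mkQ := by
  have : Subsingleton (Abelian.Ext (ModuleCat.of R X.obj) (ModuleCat.of R R) 1) :=
    X.property.2 1 one_pos
  rw [exists_stableExt_one_ne_zero_iff, ← not_forall, not_iff_not]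
  exact forall_extends_iff_liftsAlong (freeCover_surjective X) J

/-- Whether maps from a syzygy of `M` lift is independent of the choice of the syzygy. -/
theorem LiftsAlong.ker [Module.Projective R F] [Module.Projective R F'] {π : P →ₗ[R] S}
    (hπ : Function.Surjective π) {d : F →ₗ[R] M} {d' : F' →ₗ[R] M} (hd : Function.Surjective d)
    (hd' : Function.Surjective d') (H : LiftsAlong (LinearMap.ker d) π) :
    LiftsAlong (LinearMap.ker d') π := by
  intro h
  obtain ⟨α, hα⟩ := Module.projective_lifting_property d d' hd
  obtain ⟨β, hβ⟩ := Module.projective_lifting_property d' d hd'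
  have hα' (c) : d (α c) = d' c := LinearMap.congr_fun hα c
  have hβ' (c) : d' (β c) = d c := LinearMap.congr_fun hβ c
  let α' : LinearMap.ker d' →ₗ[R] LinearMap.ker d := α.restrict fun c hc => by
    simpa [hα'] using hc
  let β' : LinearMap.ker d →ₗ[R] LinearMap.ker d' := β.restrict fun c hc => by
    simpa [hβ'] using hc
  -- As in Schanuel's lemma: the identity of `ker d'` is `β' ∘ α'` plus the restriction of `γ`. The
  -- first term factors through `ker d`, the second through the projective module `F'`.
  let γ : F' →ₗ[R] LinearMap.ker d' :=
    (LinearMap.id - β ∘ₗ α).codRestrict _ fun c => by simp [hα', hβ']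
  obtain ⟨l₁, hl₁⟩ := H (h ∘ₗ β')
  obtain ⟨l₂, hl₂⟩ := Module.projective_lifting_property π (h ∘ₗ γ) hπ
  refine ⟨l₁ ∘ₗ α' + l₂ ∘ₗ (LinearMap.ker d').subtype, LinearMap.ext fun c => ?_⟩
  have h₁ := LinearMap.congr_fun hl₁ (α' c)
  have h₂ := LinearMap.congr_fun hl₂ c.1
  simp only [LinearMap.comp_apply] at h₁ h₂
  simp only [LinearMap.comp_apply, LinearMap.add_apply, map_add, Submodule.subtype_apply, h₁, h₂]
  rw [← map_add]
  congr 1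
  ext
  simp [γ, α', β']

/-- A map from a projective cover to a simple module kills the kernel of the cover. -/
theorem IsProjectiveCover.ker_le {d : F →ₗ[R] M} (hd : IsProjectiveCover d) [IsSimpleModule R S]
    (u : F →ₗ[R] S) : LinearMap.ker d ≤ LinearMap.ker u := by
  rcases eq_or_ne u 0 with rfl | hu
  · simp
  have hcoatom : IsCoatom (LinearMap.ker u) := by
    rw [← isSimpleModule_iff_isCoatom]
    exact IsSimpleModule.congr (u.quotKerEquivOfSurjective (LinearMap.surjective_of_ne_zero hu))
  -- A kernel outside the maximal submodule `ker u` would span `F` together with it, which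
  -- superfluity forbids.
  by_contra hle
  refine hcoatom.1 (hd.superfluous _ (hcoatom.2 _ (left_lt_sup.2 hle)))

variable {J : Submodule R P}

/-- A proper image would lie in `J` and vanish in the quotient. -/
theorem surjective_of_mkQ_comp_ne_zero (hP : ∀ N : Submodule R P, N ≠ ⊤ → N ≤ J)
    {l : M →ₗ[R] P} (hl : J.mkQ ∘ₗ l ≠ 0) : Function.Surjective l := by
  rw [← LinearMap.range_eq_top]
  by_contra h
  refine hl (LinearMap.ext fun c => ?_)
  simpa using hP _ h ⟨c, rfl⟩

theorem isCompl_range_ker {l : M →ₗ[R] S} {s : S →ₗ[R] M} (h : l ∘ₗ s = LinearMap.id) :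
    IsCompl (LinearMap.range s) (LinearMap.ker l) := by
  have hls (c) : l (s c) = c := LinearMap.congr_fun h c
  refine ⟨Submodule.disjoint_def.2 ?_, codisjoint_iff.2 (eq_top_iff.2 fun m _ => ?_)⟩
  · rintro _ ⟨c, rfl⟩ hc
    rw [LinearMap.mem_ker, hls] at hc
    rw [hc, map_zero]
  · rw [← add_sub_cancel (s (l m)) m]
    exact Submodule.add_mem_sup ⟨_, rfl⟩ (by simp [hls])

/-- If `P` is projective with the largest proper submodule `J`, then only the zero map from an
indecomposable non-projective module to `P / J` lifts to `P`. -/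
theorem liftsAlong_iff_of_isIndecomposable [Module.Projective R P]
    (hP : ∀ N : Submodule R P, N ≠ ⊤ → N ≤ J) (hM : IsIndecomposable R M)
    (hMP : ¬ Module.Projective R M) :
    LiftsAlong M J.mkQ ↔ ∀ h : M →ₗ[R] P ⧸ J, h = 0 := by
  refine ⟨fun H h => ?_, fun H h => ⟨0, by rw [H h, LinearMap.comp_zero]⟩⟩
  obtain ⟨l, rfl⟩ := H h
  by_contra hl
  have hs := surjective_of_mkQ_comp_ne_zero hP hl
  obtain ⟨s, hs'⟩ := Module.projective_lifting_property l LinearMap.id hs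
  have hls (c) : l (s c) = c := LinearMap.congr_fun hs' c
  -- The splitting decomposes `M`. If the copy of `P` is zero then `l = l ∘ s ∘ l` is zero, and if
  -- the kernel of `l` is zero then `M ≅ P` is projective.
  have hc := isCompl_range_ker hs'
  rcases hM.2 _ _ hc with h0 | h0
  · refine hl (LinearMap.ext fun c => ?_)
    rw [LinearMap.range_eq_bot] at h0
    have := hls (l c)
    rw [h0, LinearMap.zero_apply, map_zero] at this
    simp [← this]
  · exact hMP (Module.Projective.of_equiv
      (LinearEquiv.ofBijective l ⟨LinearMap.ker_eq_bot.1 h0, hs⟩).symm)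

/-- Only the zero map from a minimal syzygy to a simple module `P / J` lifts to `P`. -/
theorem liftsAlong_ker_iff [Module.Projective R P] [Module.Finite R P] [IsSimpleModule R (P ⧸ J)]
    [Subsingleton (Abelian.Ext (ModuleCat.of R M) (ModuleCat.of R R) 1)]
    {d : F →ₗ[R] M} (hd : IsProjectiveCover d) :
    LiftsAlong (LinearMap.ker d) J.mkQ ↔ ∀ h : LinearMap.ker d →ₗ[R] P ⧸ J, h = 0 := by
  refine ⟨fun H h => ?_, fun H h => ⟨0, by rw [H h, LinearMap.comp_zero]⟩⟩
  obtain ⟨l, rfl⟩ := H h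
  obtain ⟨l', rfl⟩ := exists_extension_to_projective (f := (LinearMap.ker d).subtype)
    (Submodule.range_subtype _) (Submodule.subtype_injective _) hd.surjective l
  ext c
  exact hd.ker_le (J.mkQ ∘ₗ l') c.2

/-- The projective module `P` with simple top `P / J` is a summand of a projective cover of `M`
if and only if there is a nonzero map from `M` to `P / J`. -/
theorem inAdd_iff_of_isProjectiveCover [Module.Projective R P] [IsSimpleModule R (P ⧸ J)]
    (hP : ∀ N : Submodule R P, N ≠ ⊤ → N ≤ J) {d : F →ₗ[R] M} (hd : IsProjectiveCover d) :
    InAdd R P F ↔ ¬ ∀ h : M →ₗ[R] P ⧸ J, h = 0 := by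
  have := hd.projective
  constructor
  · rintro ⟨n, T, hT, ⟨e⟩⟩ H
    have hJ : J.mkQ ≠ 0 := by
      intro h0
      have := IsSimpleModule.nontrivial R (P ⧸ J)
      obtain ⟨c, hc⟩ := exists_ne (0 : P ⧸ J)
      obtain ⟨c, rfl⟩ := J.mkQ_surjective c
      exact hc (by rw [h0, LinearMap.zero_apply])
    refine hJ ?_
    have hJe : J.mkQ ∘ₗ e.symm.toLinearMap = 0 := by
      refine LinearMap.pi_ext' fun i => ?_
      obtain ⟨T', hT'⟩ := hT i
      set u := (J.mkQ ∘ₗ e.symm.toLinearMap) ∘ₗ LinearMap.single R (fun i => T i) i with hu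
      -- Extended by zero to all of `F`, the map to the simple top kills `ker d` and descends to
      -- `M`, where only zero is available.
      let v : F →ₗ[R] P ⧸ J := u ∘ₗ (T i).projectionOnto T' hT'
      have hv : v = 0 := by
        obtain ⟨l, hl⟩ := exists_comp_eq_of_ker_le hd.surjective (hd.ker_le v)
        rw [← hl, H l, LinearMap.zero_comp]
      ext c
      have := LinearMap.congr_fun hv c
      simpa [v] using this
    ext c
    simpa using LinearMap.congr_fun hJe (e c)
  · intro H
    push Not at H
    obtain ⟨h, hh⟩ := H
    obtain ⟨l, hl⟩ := Module.projective_lifting_property J.mkQ (h ∘ₗ d) J.mkQ_surjective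
    have hls : Function.Surjective l := by
      refine surjective_of_mkQ_comp_ne_zero hP (J := J) fun h0 => hh ?_
      rw [hl] at h0
      ext c
      obtain ⟨c, rfl⟩ := hd.surjective c
      exact LinearMap.congr_fun h0 c
    obtain ⟨s, hs⟩ := Module.projective_lifting_property l LinearMap.id hls
    have hsi : Function.Injective s := by
      refine Function.LeftInverse.injective (g := l) fun c => LinearMap.congr_fun hs c
    refine ⟨1, fun _ => LinearMap.range s, fun _ => ⟨LinearMap.ker l, ?_⟩,
      ⟨(LinearEquiv.ofInjective s hsi).trans (LinearEquiv.funUnique (Fin 1) R _).symm⟩⟩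
    exact isCompl_range_ker hs

end Lifting

/-! ### Division by arrows in the path algebra -/

namespace PathAlgebra

variable {k : Type u} [Field k] {V : Type u} [Quiver.{u} V]

theorem induction_on {p : PathAlgebra k V → Prop} (f : PathAlgebra k V)
    (zero : p 0) (add : ∀ f g, p f → p g → p (f + g))
    (smul_path : ∀ (r : k) (i j : V) (q : Quiver.Path i j), p (r • ofPath k q)) : p f := by
  rw [← (basis k V).linearCombination_repr f]
  induction (basis k V).repr f using Finsupp.induction_linear with
  | zero => simpa using zero
  | add f g hf hg => rw [map_add]; exact add _ _ hf hg
  | single q r => rw [Finsupp.linearCombination_single]; exact smul_path r _ _ q.2.2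

/-- The coefficient of a stationary path. -/
def nilCoeffPath (x : V) : ∀ {i j : V}, Quiver.Path i j → k
  | i, _, Quiver.Path.nil => open Classical in if i = x then 1 else 0
  | _, _, Quiver.Path.cons _ _ => 0

/-- The coefficient of a stationary path, as a linear map. -/
def nilCoeffLinear (x : V) : PathAlgebra k V →ₗ[k] k :=
  (basis k V).constr k fun p => nilCoeffPath x p.2.2

theorem nilCoeffLinear_ofPath (x : V) {i j : V} (p : Quiver.Path i j) :
    nilCoeffLinear x (ofPath k p) = nilCoeffPath x p := by
  rw [nilCoeffLinear, ofPath, Module.Basis.constr_basis]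

/-- The product of two elements is determined by bilinearity. -/
theorem bilinear_ext [Fintype V] {N : Type*} [AddCommGroup N] [Module k N]
    (Φ Ψ : PathAlgebra k V →ₗ[k] PathAlgebra k V →ₗ[k] N)
    (h : ∀ {i j l m : V} (p : Quiver.Path i j) (q : Quiver.Path l m),
      Φ (ofPath k p) (ofPath k q) = Ψ (ofPath k p) (ofPath k q)) (f g : PathAlgebra k V) :
    Φ f g = Ψ f g := by
  have : Φ = Ψ := hom_ext fun i j p => hom_ext fun l m q => h p q
  rw [this]

variable [Fintype V]

theorem ofPath_nil (i : V) : ofPath k (Quiver.Path.nil : Quiver.Path i i) = vertex k i := rfl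

theorem ofPath_cons {i j l : V} (p : Quiver.Path i j) (b : j ⟶ l) :
    ofPath k (p.cons b) = ofPath k p * arrow k ⟨j, l, b⟩ :=
  (ofPath_mul_ofPath k p b.toPath).symm

theorem ofPath_mul_vertex {i j : V} (p : Quiver.Path i j) :
    ofPath k p * vertex k j = ofPath k p :=
  ofPath_mul_ofPath k p _

theorem ofPath_mul_vertex_of_ne {i j x : V} (p : Quiver.Path i j) (h : j ≠ x) :
    ofPath k p * vertex k x = 0 :=
  ofPath_mul_ofPath_of_ne k p _ h

theorem vertex_mul_ofPath {i j : V} (p : Quiver.Path i j) :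
    vertex k i * ofPath k p = ofPath k p :=
  (ofPath_mul_ofPath k _ p).trans (by rw [Quiver.Path.nil_comp])

theorem vertex_mul_ofPath_of_ne {i j x : V} (p : Quiver.Path i j) (h : x ≠ i) :
    vertex k x * ofPath k p = 0 :=
  ofPath_mul_ofPath_of_ne k _ p h

theorem vertex_mul_arrow (a : Quiver.Total V) : vertex k a.left * arrow k a = arrow k a :=
  vertex_mul_ofPath _

theorem vertex_mul_arrow_of_ne (a : Quiver.Total V) {x : V} (h : x ≠ a.left) :
    vertex k x * arrow k a = 0 :=
  vertex_mul_ofPath_of_ne _ h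

theorem arrow_mul_vertex (a : Quiver.Total V) : arrow k a * vertex k a.right = arrow k a :=
  ofPath_mul_vertex _

theorem vertex_mul_vertex (x : V) : vertex k x * vertex k x = vertex k x :=
  vertex_mul_ofPath _

theorem sum_vertex : ∑ x : V, vertex k x = 1 := rfl

/-- A concatenation is stationary at `x` only if both factors are. -/
theorem nilCoeffLinear_mul (x : V) (f g : PathAlgebra k V) :
    nilCoeffLinear x (f * g) = nilCoeffLinear x f * nilCoeffLinear x g := by
  have h := bilinear_ext (N := k) ((LinearMap.mul k (PathAlgebra k V)).compr₂ (nilCoeffLinear x))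
    ((LinearMap.mul k k).compl₁₂ (nilCoeffLinear x) (nilCoeffLinear x)) ?_ f g
  · simpa using h
  intro i j l m p q
  simp only [LinearMap.compr₂_apply, LinearMap.mul_apply', LinearMap.compl₁₂_apply,
    nilCoeffLinear_ofPath]
  by_cases h : j = l
  · subst h
    rw [ofPath_mul_ofPath, nilCoeffLinear_ofPath]
    cases q with
    | nil =>
      cases p with
      | nil => by_cases h : i = x <;> simp [nilCoeffPath, h]
      | cons p b => simp [nilCoeffPath]
    | cons q b => simp [nilCoeffPath]
  · rw [ofPath_mul_ofPath_of_ne k p q h, map_zero]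
    cases q with
    | nil =>
      cases p with
      | nil =>
        simp only [nilCoeffPath]
        split_ifs with h₁ h₂
        · exact absurd (h₁.trans h₂.symm) h
        all_goals simp
      | cons p b => simp [nilCoeffPath]
    | cons q b => simp [nilCoeffPath]

/-- The coefficient of a stationary path is a homomorphism of algebras. -/
def nilCoeff (x : V) : PathAlgebra k V →ₐ[k] k :=
  AlgHom.ofLinearMap (nilCoeffLinear x)
    (by
      rw [one_def, map_sum, Finset.sum_eq_single x]
      · simp [nilCoeffLinear_ofPath, nilCoeffPath]
      · intro y _ hy
        simp [nilCoeffLinear_ofPath, nilCoeffPath, hy]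
      · simp)
    (nilCoeffLinear_mul x)

theorem nilCoeff_ofPath (x : V) {i j : V} (p : Quiver.Path i j) :
    nilCoeff x (ofPath k p) = nilCoeffPath x p :=
  nilCoeffLinear_ofPath x p

open Classical in
theorem nilCoeff_vertex (x y : V) : nilCoeff x (vertex k y) = if y = x then 1 else 0 :=
  nilCoeff_ofPath x _

theorem nilCoeff_arrow (x : V) (a : Quiver.Total V) : nilCoeff x (arrow k a) = 0 :=
  nilCoeff_ofPath x _

/-- Division by an arrow from the left on paths: the path `a p` is sent to `p`. -/
def leftDivPath (a : Quiver.Total V) : ∀ {i j : V}, Quiver.Path i j → PathAlgebra k V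
  | _, _, Quiver.Path.nil => 0
  -- Paths grow at their end, so removing the first arrow is recursive. The second summand treats
  -- the case in which the last arrow is also the first, that is, `p` is stationary.
  | _, _, Quiver.Path.cons (b := j) (c := l) p b => leftDivPath a p * arrow k ⟨j, l, b⟩ +
      nilCoeffPath (k := k) a.left p • open Classical in
        if (⟨j, l, b⟩ : Quiver.Total V) = a then vertex k a.right else 0

/-- Division by an arrow from the left: a path `a p` is sent to `p`, the other paths to zero. -/
def leftDiv (a : Quiver.Total V) : PathAlgebra k V →ₗ[k] PathAlgebra k V :=
  (basis k V).constr k fun p => leftDivPath a p.2.2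

theorem leftDiv_ofPath (a : Quiver.Total V) {i j : V} (p : Quiver.Path i j) :
    leftDiv a (ofPath k p) = leftDivPath a p := by
  rw [leftDiv, ofPath, Module.Basis.constr_basis]

theorem leftDiv_vertex (a : Quiver.Total V) (x : V) : leftDiv a (vertex k x) = 0 :=
  (leftDiv_ofPath a _).trans (by rw [leftDivPath])

open Classical in
theorem leftDiv_arrow (a b : Quiver.Total V) :
    leftDiv a (arrow k b) = if b = a then vertex k a.right else 0 := by
  rw [arrow, leftDiv_ofPath, Quiver.Hom.toPath, leftDivPath, leftDivPath, zero_mul, zero_add,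
    nilCoeffPath]
  by_cases h : b = a
  · subst h
    simp
  · simp [h]

theorem leftDivPath_mul_vertex (a : Quiver.Total V) {i j : V} (p : Quiver.Path i j) :
    leftDivPath a p * vertex k j = leftDivPath a p := by
  cases p with
  | nil => simp [leftDivPath]
  | cons p b =>
    rw [leftDivPath, add_mul, mul_assoc, arrow_mul_vertex ⟨_, _, b⟩, smul_mul_assoc]
    split_ifs with h
    · subst h
      rw [vertex_mul_vertex]
    · rw [zero_mul]

theorem leftDivPath_of_ne (a : Quiver.Total V) {i j : V} (p : Quiver.Path i j) (h : i ≠ a.left) :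
    leftDivPath (k := k) a p = 0 := by
  induction p with
  | nil => rw [leftDivPath]
  | cons p b ih =>
    rw [leftDivPath, ih, zero_mul, zero_add]
    cases p with
    | nil => simp [nilCoeffPath, h]
    | cons p c => simp [nilCoeffPath]

/-- The product rule of Fox calculus: the first arrow of a product comes from `f`, unless the part
of `f` involved is stationary at the source of `a`. -/
theorem leftDiv_mul (a : Quiver.Total V) (f g : PathAlgebra k V) :
    leftDiv a (f * g) = leftDiv a f * g + nilCoeff a.left f • leftDiv a g := by
  refine bilinear_ext ((LinearMap.mul k _).compr₂ (leftDiv a))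
    ((LinearMap.mul k _).comp (leftDiv a) +
      (LinearMap.lsmul k (PathAlgebra k V)).compl₁₂ (nilCoeff a.left).toLinearMap (leftDiv a))
    ?_ f g
  intro i j l m p q
  simp only [LinearMap.compr₂_apply, LinearMap.mul_apply', LinearMap.compl₁₂_apply,
    LinearMap.add_apply, LinearMap.comp_apply, AlgHom.toLinearMap_apply, LinearMap.lsmul_apply,
    nilCoeff_ofPath, leftDiv_ofPath]
  by_cases h : j = l
  · subst h
    rw [ofPath_mul_ofPath, leftDiv_ofPath]
    induction q with
    | nil => simp [ofPath_nil, leftDivPath_mul_vertex, leftDivPath]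
    | cons q b ih =>
      have h := nilCoeff_ofPath (k := k) a.left (p.comp q)
      rw [← ofPath_mul_ofPath, map_mul, nilCoeff_ofPath, nilCoeff_ofPath] at h
      rw [Quiver.Path.comp_cons, leftDivPath, ih, ofPath_cons, leftDivPath, ← h]
      simp only [add_mul, smul_add, smul_mul_assoc, mul_assoc, smul_smul, add_assoc]
  · rw [ofPath_mul_ofPath_of_ne k p q h, map_zero, ← leftDivPath_mul_vertex, mul_assoc,
      vertex_mul_ofPath_of_ne q h, mul_zero, zero_add]
    cases p with
    | nil =>
      by_cases hi : i = a.left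
      · rw [leftDivPath_of_ne a q (fun h' => h (hi.trans h'.symm)), smul_zero]
      · simp [nilCoeffPath, hi]
    | cons p b => simp [nilCoeffPath]

/-- Division by an arrow from the right on paths: the path `p b` is sent to `p`. -/
def rightDivPath (b : Quiver.Total V) : ∀ {i j : V}, Quiver.Path i j → PathAlgebra k V
  | _, _, Quiver.Path.nil => 0
  | _, _, Quiver.Path.cons (b := j) (c := l) p c =>
      open Classical in if (⟨j, l, c⟩ : Quiver.Total V) = b then ofPath k p else 0

/-- Division by an arrow from the right: a path `p b` is sent to `p`, the other paths to zero. -/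
def rightDiv (b : Quiver.Total V) : PathAlgebra k V →ₗ[k] PathAlgebra k V :=
  (basis k V).constr k fun p => rightDivPath b p.2.2

theorem rightDiv_ofPath (b : Quiver.Total V) {i j : V} (p : Quiver.Path i j) :
    rightDiv b (ofPath k p) = rightDivPath b p := by
  rw [rightDiv, ofPath, Module.Basis.constr_basis]

theorem rightDiv_vertex (b : Quiver.Total V) (x : V) : rightDiv b (vertex k x) = 0 :=
  (rightDiv_ofPath b _).trans (by rw [rightDivPath])

open Classical in
theorem rightDiv_arrow (a b : Quiver.Total V) :
    rightDiv b (arrow k a) = if a = b then vertex k b.left else 0 := by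
  rw [arrow, rightDiv_ofPath, Quiver.Hom.toPath, rightDivPath]
  by_cases h : a = b
  · subst h
    simp [ofPath_nil]
  · simp [h]

theorem rightDivPath_of_ne (b : Quiver.Total V) {i j : V} (p : Quiver.Path i j)
    (h : j ≠ b.right) : rightDivPath (k := k) b p = 0 := by
  cases p with
  | nil => rw [rightDivPath]
  | cons p c =>
    rw [rightDivPath, if_neg]
    rintro rfl
    exact h rfl

theorem rightDiv_mul (b : Quiver.Total V) (f g : PathAlgebra k V) :
    rightDiv b (f * g) = f * rightDiv b g + nilCoeff b.right g • rightDiv b f := by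
  refine bilinear_ext ((LinearMap.mul k _).compr₂ (rightDiv b))
    ((LinearMap.mul k _).compl₂ (rightDiv b) +
      ((LinearMap.lsmul k (PathAlgebra k V)).compl₁₂ (nilCoeff b.right).toLinearMap
        (rightDiv b)).flip) ?_ f g
  intro i j l m p q
  simp only [LinearMap.compr₂_apply, LinearMap.mul_apply', LinearMap.compl₁₂_apply,
    LinearMap.add_apply, LinearMap.compl₂_apply, LinearMap.flip_apply, AlgHom.toLinearMap_apply,
    LinearMap.lsmul_apply, nilCoeff_ofPath, rightDiv_ofPath]
  by_cases h : j = l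
  · subst h
    rw [ofPath_mul_ofPath, rightDiv_ofPath]
    cases q with
    | nil =>
      by_cases hj : j = b.right
      · simp [rightDivPath, nilCoeffPath, hj]
      · rw [Quiver.Path.comp_nil, rightDivPath_of_ne b p hj, rightDivPath, mul_zero, zero_add,
          smul_zero]
    | cons q c =>
      rw [Quiver.Path.comp_cons, rightDivPath, rightDivPath, nilCoeffPath, zero_smul, add_zero]
      split_ifs <;> simp [ofPath_mul_ofPath]
  · rw [ofPath_mul_ofPath_of_ne k p q h, map_zero]
    cases q with
    | nil =>
      by_cases hj : l = b.right
      · rw [rightDivPath_of_ne b p (fun h' => h (h'.trans hj.symm))]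
        simp [rightDivPath]
      · simp [rightDivPath, nilCoeffPath, hj]
    | cons q c =>
      rw [rightDivPath, nilCoeffPath, zero_smul, add_zero]
      split_ifs <;> simp [ofPath_mul_ofPath_of_ne k p q h]

variable [Fintype (Quiver.Total V)]

theorem sum_nilCoeff_smul_vertex_mul_arrow (f : PathAlgebra k V) (a : Quiver.Total V) :
    (∑ x, nilCoeff x f • vertex k x) * arrow k a = nilCoeff a.left f • arrow k a := by
  rw [Finset.sum_mul, Finset.sum_eq_single a.left]
  · rw [smul_mul_assoc, vertex_mul_arrow]
  · intro x _ hx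
    rw [smul_mul_assoc, vertex_mul_arrow_of_ne _ hx, smul_zero]
  · simp

/-- A path is either stationary or has a unique first arrow, so the quotients by arrows recover the
element. -/
theorem eq_sum_arrow_mul_leftDiv (f : PathAlgebra k V) :
    f = ∑ x, nilCoeff x f • vertex k x + ∑ a, arrow k a * leftDiv a f := by
  induction f using induction_on with
  | zero => simp
  | add f g hf hg =>
    simp only [map_add, add_smul, mul_add, Finset.sum_add_distrib]
    nth_rw 1 [hf, hg]
    abel
  | smul_path r i j p =>
    simp only [map_smul, smul_assoc, mul_smul_comm, ← Finset.smul_sum, ← smul_add]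
    congr 1
    classical
    induction p with
    | nil => simp [ofPath_nil, leftDiv_vertex, nilCoeff_vertex]
    | cons p b ih =>
      simp only [ofPath_cons, map_mul, nilCoeff_arrow, mul_zero, zero_smul,
        Finset.sum_const_zero, zero_add, leftDiv_mul, leftDiv_arrow, mul_add]
      rw [Finset.sum_add_distrib]
      simp only [← mul_assoc]
      -- By induction the quotients of `p` give `p * b` up to its stationary part times `b`. The
      -- summand for the arrow `b` supplies exactly this difference.
      rw [← Finset.sum_mul, ← sub_eq_iff_eq_add'.2 ih, sub_mul,
        sum_nilCoeff_smul_vertex_mul_arrow, Finset.sum_eq_single ⟨_, _, b⟩]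
      · simp [arrow_mul_vertex ⟨_, _, b⟩]
      · intro a _ ha
        simp [Ne.symm ha]
      · simp

theorem eq_sum_rightDiv_mul_arrow (f : PathAlgebra k V) :
    f = ∑ x, nilCoeff x f • vertex k x + ∑ b, rightDiv b f * arrow k b := by
  induction f using induction_on with
  | zero => simp
  | add f g hf hg =>
    simp only [map_add, add_smul, add_mul, Finset.sum_add_distrib]
    nth_rw 1 [hf, hg]
    abel
  | smul_path r i j p =>
    simp only [map_smul, smul_assoc, smul_mul_assoc, ← Finset.smul_sum, ← smul_add]
    congr 1
    classical
    cases p with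
    | nil => simp [ofPath_nil, rightDiv_vertex, nilCoeff_vertex]
    | cons p b =>
      simp only [nilCoeff_ofPath, nilCoeffPath, rightDiv_ofPath, rightDivPath, zero_smul,
        Finset.sum_const_zero, zero_add, ite_mul, zero_mul, Finset.sum_ite_eq, Finset.mem_univ,
        if_true]
      exact ofPath_cons p b

end PathAlgebra

/-! ### Cyclic derivatives -/

section CyclicDerivative

open PathAlgebra

variable (k : Type u) [Field k] {V : Type u} [Quiver.{u} V] [Fintype V]

open Classical in
/-- The contribution of one rotation of a cyclic path to its cyclic derivative. -/
def derivTerm (α : Quiver.Total V) (l : List (Quiver.Total V)) : PathAlgebra k V :=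
  match l with
  | [] => 0
  | a :: p => if a = α then vertex k α.right * (p.map (arrow k)).prod else 0

theorem cyclicDerivative_eq (α : Quiver.Total V) (c : Cycle (Quiver.Total V)) :
    cyclicDerivative k α c = (c.lists.map (derivTerm k α)).sum := by
  rw [cyclicDerivative]
  congr 2

/-- Rotation permutes the words representing a cycle; this reindexing turns left quotients of
derivatives into right quotients. -/
theorem map_rotate_lists {T : Type*} (c : Cycle T) :
    c.lists.map (fun l => l.rotate 1) = c.lists := by
  induction c using Quotient.inductionOn' with
  | h l =>
    change (((l : Cycle T).lists).map fun l => l.rotate 1) = (l : Cycle T).lists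
    rw [Cycle.lists_coe, Multiset.map_coe]
    have : l.cyclicPermutations.map (fun l => l.rotate 1) = (l.rotate 1).cyclicPermutations := by
      refine List.ext_getElem (by simp) fun i h₁ h₂ => ?_
      rw [List.getElem_map, List.getElem_cyclicPermutations, List.getElem_cyclicPermutations,
        List.rotate_rotate, List.rotate_rotate, add_comm]
    rw [this, List.cyclicPermutations_rotate]
    exact Multiset.coe_eq_coe.2 (List.rotate_perm _ _)

theorem vertex_mul_prod_mul_vertex (c b : Quiver.Total V) (q : List (Quiver.Total V))
    (h : List.IsChain (fun a b : Quiver.Total V => a.right = b.left) (c :: (q ++ [b]))) :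
    vertex k c.right * (q.map (arrow k)).prod * vertex k b.left =
      vertex k c.right * (q.map (arrow k)).prod := by
  induction q generalizing c with
  | nil =>
    have : c.right = b.left := by simpa using h
    simp [this, vertex_mul_vertex]
  | cons d q ih =>
    have ih' := ih d (List.isChain_cons_cons.1 h).2
    rw [List.map_cons, List.prod_cons, ← arrow_mul_vertex d]
    simp only [mul_assoc] at ih' ⊢
    rw [ih']

/-- Closed paths of length at least two, up to rotation. -/
def IsClosedPath (c : Cycle (Quiver.Total V)) : Prop :=
  (c.Chain fun a b => a.right = b.left) ∧ 2 ≤ c.length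

variable {k} {c : Cycle (Quiver.Total V)}

theorem IsClosedPath.exists_of_mem_lists (hc : IsClosedPath c) {l : List (Quiver.Total V)}
    (hl : l ∈ c.lists) : ∃ a b q, l = a :: b :: q ∧
      List.IsChain (fun a b : Quiver.Total V => a.right = b.left) (a :: (b :: q ++ [a])) := by
  rw [Cycle.mem_lists_iff_coe_eq] at hl
  subst hl
  obtain ⟨h, h'⟩ := hc
  match l, h, h' with
  | [], h, h' => simp at h'
  | [a], h, h' => simp at h'
  | a :: b :: q, h, h' => exact ⟨a, b, q, rfl, (Cycle.chain_coe_cons _ _ _).1 h⟩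

theorem IsClosedPath.cyclicDerivative_mul_vertex (hc : IsClosedPath c) (β : Quiver.Total V) :
    cyclicDerivative k β c * vertex k β.left = cyclicDerivative k β c := by
  rw [cyclicDerivative_eq, Multiset.sum_map_mul_right.symm]
  congr 1
  refine Multiset.map_congr rfl fun l hl => ?_
  obtain ⟨a, b, q, rfl, h⟩ := hc.exists_of_mem_lists hl
  rw [derivTerm]
  split_ifs with hab
  · subst hab
    exact vertex_mul_prod_mul_vertex k a a (b :: q) h
  · rw [zero_mul]

theorem vertex_mul_cyclicDerivative (β : Quiver.Total V) :
    vertex k β.right * cyclicDerivative k β c = cyclicDerivative k β c := by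
  rw [cyclicDerivative_eq, Multiset.sum_map_mul_left.symm]
  congr 1
  refine Multiset.map_congr rfl fun l hl => ?_
  cases l with
  | nil => rw [derivTerm, mul_zero]
  | cons a p =>
    rw [derivTerm]
    split_ifs
    · rw [← mul_assoc, vertex_mul_vertex]
    · rw [mul_zero]

/-- Length at least two enters here: the derivative of a loop by itself is a stationary path. -/
theorem IsClosedPath.nilCoeff_cyclicDerivative (hc : IsClosedPath c) (β : Quiver.Total V)
    (x : V) : nilCoeff x (cyclicDerivative k β c) = 0 := by
  rw [cyclicDerivative_eq, map_multiset_sum, Multiset.map_map]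
  refine Multiset.sum_eq_zero fun r hr => ?_
  obtain ⟨l, hl, rfl⟩ := Multiset.mem_map.1 hr
  obtain ⟨a, b, q, rfl, h⟩ := hc.exists_of_mem_lists hl
  rw [Function.comp_apply, derivTerm]
  split_ifs
  · simp [nilCoeff_arrow]
  · rw [map_zero]

/-- The second cyclic derivatives of a closed path are symmetric. -/
theorem IsClosedPath.leftDiv_cyclicDerivative (hc : IsClosedPath c) (α β : Quiver.Total V) :
    leftDiv α (cyclicDerivative k β c) = rightDiv β (cyclicDerivative k α c) := by
  -- The word `β α q` contributes `q` on the left, after removing its first two letters. Its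
  -- rotation `α q β` contributes the same `q` on the right, after removing its first and last
  -- letters.
  conv_rhs => rw [cyclicDerivative_eq, ← map_rotate_lists c]
  rw [cyclicDerivative_eq, map_multiset_sum, map_multiset_sum, Multiset.map_map, Multiset.map_map,
    Multiset.map_map]
  congr 1
  refine Multiset.map_congr rfl fun l hl => ?_
  obtain ⟨a, b, q, rfl, h⟩ := hc.exists_of_mem_lists hl
  have hrot : (a :: b :: q).rotate 1 = b :: (q ++ [a]) := by simp
  simp only [Function.comp_apply, hrot, derivTerm]
  by_cases hb : b = α
  · subst hb
    by_cases ha : a = β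
    · subst ha
      have hab : a.right = b.left := (List.isChain_cons_cons.1 h).1
      have := vertex_mul_prod_mul_vertex k b a q (List.isChain_cons_cons.1 h).2
      simp [leftDiv_mul, leftDiv_vertex, leftDiv_arrow, rightDiv_mul, rightDiv_arrow,
        nilCoeff_vertex, nilCoeff_arrow, hab, ← mul_assoc, this]
    · simp [ha, rightDiv_mul, rightDiv_arrow, nilCoeff_arrow]
  · by_cases ha : a = β
    · simp [ha, hb, leftDiv_mul, leftDiv_vertex, leftDiv_arrow, nilCoeff_arrow]
    · simp [ha, hb]

/-- Potentials that are supported on closed paths of length at least two. -/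
def Potential.IsClosed (W : Potential k V) : Prop := ∀ c ∈ W.support, IsClosedPath c

namespace Potential

variable {W : Potential k V}

theorem vertex_mul_derivative (W : Potential k V) (β : Quiver.Total V) :
    vertex k β.right * W.derivative β = W.derivative β := by
  rw [derivative, Finsupp.sum, Finset.mul_sum]
  exact Finset.sum_congr rfl fun c hc => by rw [mul_smul_comm, vertex_mul_cyclicDerivative]

theorem IsClosed.derivative_mul_vertex (hW : W.IsClosed) (β : Quiver.Total V) :
    W.derivative β * vertex k β.left = W.derivative β := by
  rw [derivative, Finsupp.sum, Finset.sum_mul]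
  exact Finset.sum_congr rfl fun c hc => by
    rw [smul_mul_assoc, (hW c hc).cyclicDerivative_mul_vertex]

theorem IsClosed.nilCoeff_derivative (hW : W.IsClosed) (β : Quiver.Total V) (x : V) :
    nilCoeff x (W.derivative β) = 0 := by
  rw [derivative, Finsupp.sum, map_sum]
  exact Finset.sum_eq_zero fun c hc => by
    rw [map_smul, (hW c hc).nilCoeff_cyclicDerivative, smul_zero]

theorem IsClosed.leftDiv_derivative (hW : W.IsClosed) (α β : Quiver.Total V) :
    leftDiv α (W.derivative β) = rightDiv β (W.derivative α) := by
  rw [derivative, derivative, Finsupp.sum, Finsupp.sum, map_sum, map_sum]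
  exact Finset.sum_congr rfl fun c hc => by
    rw [map_smul, map_smul, (hW c hc).leftDiv_cyclicDerivative]

end Potential

end CyclicDerivative

/-! ### The relations of a Jacobian algebra -/

namespace JacobianAlgebra

open PathAlgebra

variable {k : Type u} [Field k] {V : Type u} [Quiver.{u} V] [Fintype V] (W : Potential k V)

theorem mk_surjective : Function.Surjective (mk W) :=
  RingQuot.mkAlgHom_surjective k _

theorem mk_derivative (α : Quiver.Total V) : mk W (W.derivative α) = 0 := by
  rw [← map_zero (mk W)]
  exact RingQuot.mkAlgHom_rel k ⟨α, rfl, rfl⟩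

variable {W}

/-- The kernel of the quotient map is contained in every two-sided ideal that contains the cyclic
derivatives. -/
theorem mem_of_mk_eq_zero {D : TwoSidedIdeal (PathAlgebra k V)} (hD : ∀ α, W.derivative α ∈ D)
    {f : PathAlgebra k V} (hf : mk W f = 0) : f ∈ D := by
  let r : PathAlgebra k V → PathAlgebra k V → Prop := fun x y =>
    ∃ α : Quiver.Total V, x = W.derivative α ∧ y = 0
  have hr : ∀ ⦃x y⦄, r x y → D.ringCon.mk' x = D.ringCon.mk' y := by
    rintro _ _ ⟨α, rfl, rfl⟩
    exact (RingCon.eq _).2 ((TwoSidedIdeal.mem_iff _ _).1 (hD α))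
  have h : RingQuot.mkRingHom r f = 0 := by
    rw [← RingQuot.mkAlgHom_coe k r]
    exact hf
  have h2 := congrArg (RingQuot.lift ⟨D.ringCon.mk', hr⟩) h
  rw [RingQuot.lift_mkRingHom_apply, map_zero] at h2
  exact (TwoSidedIdeal.mem_iff _ _).2 ((RingCon.eq _).1 h2)

/-- An algebra homomorphism on the Jacobian algebra is a homomorphism on the path algebra that
kills the cyclic derivatives. -/
def lift {S : Type*} [Ring S] [Algebra k S] (f : PathAlgebra k V →ₐ[k] S)
    (hf : ∀ α, f (W.derivative α) = 0) : JacobianAlgebra W →ₐ[k] S :=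
  RingQuot.liftAlgHom k ⟨f, by
    rintro _ _ ⟨α, rfl, rfl⟩
    rw [hf, map_zero]⟩

theorem lift_mk {S : Type*} [Ring S] [Algebra k S] (f : PathAlgebra k V →ₐ[k] S)
    (hf : ∀ α, f (W.derivative α) = 0) (x : PathAlgebra k V) : lift f hf (mk W x) = f x :=
  RingQuot.liftAlgHom_mkAlgHom_apply k f _ x

variable (W)

/-- The class of a vertex. -/
def e (x : V) : JacobianAlgebra W := mk W (vertex k x)

/-- The class of an arrow. -/
def arr (a : Quiver.Total V) : JacobianAlgebra W := mk W (arrow k a)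

/-- The class of the second derivative of the potential. -/
def secondDerivative (β a : Quiver.Total V) : JacobianAlgebra W :=
  mk W (leftDiv a (W.derivative β))

theorem secondDerivative_of_ne {a β : Quiver.Total V} (h : β.right ≠ a.left) :
    secondDerivative W β a = 0 := by
  classical
  rw [secondDerivative, ← W.vertex_mul_derivative, leftDiv_mul, leftDiv_vertex, nilCoeff_vertex,
    if_neg h, zero_mul, zero_smul, add_zero, map_zero]

theorem e_mul_e (x : V) : e W x * e W x = e W x := by
  rw [e, ← map_mul, vertex_mul_vertex]

theorem sum_e : ∑ x, e W x = 1 := by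
  rw [← map_one (mk W), ← sum_vertex, map_sum]
  rfl

theorem e_mul_arr (a : Quiver.Total V) : e W a.left * arr W a = arr W a := by
  rw [e, arr, ← map_mul, vertex_mul_arrow]

theorem e_mul_arr_of_ne {a : Quiver.Total V} {x : V} (h : x ≠ a.left) : e W x * arr W a = 0 := by
  rw [e, arr, ← map_mul, vertex_mul_arrow_of_ne _ h, map_zero]

theorem arr_mul_e (a : Quiver.Total V) : arr W a * e W a.right = arr W a := by
  rw [e, arr, ← map_mul, arrow_mul_vertex]

theorem secondDerivative_mul_e (hW : W.IsClosed) (a β : Quiver.Total V) :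
    secondDerivative W β a * e W β.left = secondDerivative W β a := by
  conv_rhs => rw [secondDerivative, ← hW.derivative_mul_vertex, leftDiv_mul, leftDiv_vertex,
    smul_zero, add_zero, map_mul]
  rfl

variable {W}

variable [Fintype (Quiver.Total V)]

/-- The elements of the path algebra whose components after division by an arrow are combinations
of second derivatives. -/
def relationIdeal (W : Potential k V) : TwoSidedIdeal (PathAlgebra k V) :=
  TwoSidedIdeal.mk' {f | (∀ x, nilCoeff x f = 0) ∧ mk W f = 0 ∧
      (∃ v : Quiver.Total V → JacobianAlgebra W, ∀ a,
        mk W (leftDiv a f) = ∑ β, secondDerivative W β a * v β) ∧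
      ∃ v : Quiver.Total V → JacobianAlgebra W, ∀ β,
        mk W (rightDiv β f) = ∑ a, v a * secondDerivative W β a}
    ⟨by simp, by simp, ⟨0, by simp⟩, ⟨0, by simp⟩⟩
    (by
      rintro f g ⟨h₁, h₂, ⟨v, hv⟩, w, hw⟩ ⟨h₁', h₂', ⟨v', hv'⟩, w', hw'⟩
      exact ⟨fun x => by rw [map_add, h₁, h₁', add_zero], by rw [map_add, h₂, h₂', add_zero],
        ⟨v + v', fun a => by simp [hv, hv', mul_add, Finset.sum_add_distrib]⟩,
        ⟨w + w', fun a => by simp [hw, hw', add_mul, Finset.sum_add_distrib]⟩⟩)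
    (by
      rintro f ⟨h₁, h₂, ⟨v, hv⟩, w, hw⟩
      exact ⟨fun x => by rw [map_neg, h₁, neg_zero], by rw [map_neg, h₂, neg_zero],
        ⟨-v, fun a => by simp [hv]⟩, ⟨-w, fun a => by simp [hw]⟩⟩)
    (by
      rintro g f ⟨h₁, h₂, ⟨v, hv⟩, w, hw⟩
      refine ⟨fun x => by rw [map_mul, h₁, mul_zero], by rw [map_mul, h₂, mul_zero],
        ⟨fun β => nilCoeff β.right g • v β, fun a => ?_⟩,
        ⟨fun a => mk W g * w a, fun β => ?_⟩⟩
      -- The first term of the product rule dies because `f` is zero in the quotient. The remaining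
      -- scalar depends on the source of `a`, which is the target of every `β` with a nonzero second
      -- derivative; so it can be absorbed into the coefficient of `β`.
      · rw [leftDiv_mul, map_add, map_mul, h₂, mul_zero, zero_add, map_smul, hv, Finset.smul_sum]
        refine Finset.sum_congr rfl fun β _ => ?_
        by_cases h : β.right = a.left
        · rw [← h, mul_smul_comm]
        · rw [secondDerivative_of_ne W h, zero_mul, zero_mul, smul_zero]
      · rw [rightDiv_mul, h₁, zero_smul, add_zero, map_mul, hw, Finset.mul_sum]
        simp only [mul_assoc])
    (by
      rintro f g ⟨h₁, h₂, ⟨v, hv⟩, w, hw⟩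
      refine ⟨fun x => by rw [map_mul, h₁, zero_mul], by rw [map_mul, h₂, zero_mul],
        ⟨fun β => v β * mk W g, fun a => ?_⟩,
        ⟨fun a => nilCoeff a.left g • w a, fun β => ?_⟩⟩
      · rw [leftDiv_mul, h₁, zero_smul, add_zero, map_mul, hv, Finset.sum_mul]
        simp only [mul_assoc]
      · rw [rightDiv_mul, map_add, map_mul, h₂, zero_mul, zero_add, map_smul, hw, Finset.smul_sum]
        refine Finset.sum_congr rfl fun a _ => ?_
        by_cases h : β.right = a.left
        · rw [h, smul_mul_assoc]
        · rw [secondDerivative_of_ne W h, mul_zero, mul_zero, smul_zero])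

/-- The kernel is generated by the first derivatives, whose quotients by arrows are second
derivatives, and the product rules propagate this form to the ideal. By symmetry the left and right
quotients involve the same matrix of second derivatives. -/
theorem mem_relationIdeal (hW : W.IsClosed) {f : PathAlgebra k V} (hf : mk W f = 0) :
    (∃ v : Quiver.Total V → JacobianAlgebra W, ∀ a,
      mk W (leftDiv a f) = ∑ β, secondDerivative W β a * v β) ∧
    ∃ v : Quiver.Total V → JacobianAlgebra W, ∀ β,
      mk W (rightDiv β f) = ∑ a, v a * secondDerivative W β a := by
  classical
  have : f ∈ relationIdeal W := by
    refine mem_of_mk_eq_zero (fun α => ?_) hf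
    rw [relationIdeal, TwoSidedIdeal.mem_mk']
    refine ⟨hW.nilCoeff_derivative α, mk_derivative W α, ⟨Pi.single α 1, fun a => ?_⟩,
      Pi.single α 1, fun β => ?_⟩
    · rw [Finset.sum_eq_single α]
      · rw [Pi.single_eq_same, mul_one, secondDerivative]
      · intro β _ h
        rw [Pi.single_eq_of_ne h, mul_zero]
      · simp
    · rw [Finset.sum_eq_single α]
      · rw [Pi.single_eq_same, one_mul, secondDerivative, hW.leftDiv_derivative]
      · intro β _ h
        rw [Pi.single_eq_of_ne h, zero_mul]
      · simp
  rw [relationIdeal, TwoSidedIdeal.mem_mk'] at this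
  exact this.2.2

/-- This is the first derivative at `β`, reassembled from its left quotients, and so a relation of
the algebra. -/
theorem sum_arr_mul_secondDerivative (hW : W.IsClosed) (β : Quiver.Total V) :
    ∑ a, arr W a * secondDerivative W β a = 0 := by
  have h := congrArg (mk W) (eq_sum_arrow_mul_leftDiv (W.derivative β))
  simp only [hW.nilCoeff_derivative, zero_smul, Finset.sum_const_zero, zero_add, mk_derivative,
    map_sum, map_mul] at h
  exact h.symm

theorem sum_secondDerivative_mul_arr (hW : W.IsClosed) (a : Quiver.Total V) :
    ∑ β, secondDerivative W β a * arr W β = 0 := by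
  have h := congrArg (mk W) (eq_sum_rightDiv_mul_arrow (W.derivative a))
  simp only [hW.nilCoeff_derivative, zero_smul, Finset.sum_const_zero, zero_add, mk_derivative,
    map_sum, map_mul, ← hW.leftDiv_derivative] at h
  exact h.symm

open Classical in
/-- The second derivatives generate the relations between the arrows that start at `x`. -/
theorem exists_eq_sum_secondDerivative_mul (hW : W.IsClosed) (x : V)
    (p : Quiver.Total V → JacobianAlgebra W)
    (hp : ∑ a, (if a.left = x then arr W a * p a else 0) = 0) :
    ∃ v : Quiver.Total V → JacobianAlgebra W, ∀ a,
      (if a.left = x then e W a.right * p a else 0) = ∑ β, secondDerivative W β a * v β := by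
  choose q hq using fun a => mk_surjective W (p a)
  -- Lifted to the path algebra, the relation is an element of the kernel, and dividing it by each
  -- arrow recovers its coefficients.
  let f := ∑ a : Quiver.Total V, if a.left = x then arrow k a * q a else 0
  have hf : mk W f = 0 := by
    rw [map_sum, ← hp]
    refine Finset.sum_congr rfl fun a _ => ?_
    split_ifs
    · rw [map_mul, hq, arr]
    · rw [map_zero]
  obtain ⟨⟨v, hv⟩, -⟩ := mem_relationIdeal hW hf
  refine ⟨v, fun a => ?_⟩
  rw [← hv, map_sum, Finset.sum_eq_single a]
  · split_ifs
    · simp [leftDiv_mul, leftDiv_arrow, nilCoeff_arrow, hq, e]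
    · simp
  · intro b _ hb
    split_ifs
    · simp [leftDiv_mul, leftDiv_arrow, nilCoeff_arrow, hb]
    · simp
  · simp

/-- The second derivatives generate the relations between the arrows as elements of the left
module. -/
theorem exists_eq_sum_mul_secondDerivative (hW : W.IsClosed)
    (b : Quiver.Total V → JacobianAlgebra W) (hb : ∀ β, b β * e W β.left = b β)
    (hb' : ∑ β, b β * arr W β = 0) :
    ∃ c : Quiver.Total V → JacobianAlgebra W, ∀ β, b β = ∑ a, c a * secondDerivative W β a := by
  classical
  choose q hq using fun a => mk_surjective W (b a)
  have hf : mk W (∑ β, q β * arrow k β) = 0 := by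
    simpa only [map_sum, map_mul, hq, arr] using hb'
  obtain ⟨-, v, hv⟩ := mem_relationIdeal hW hf
  refine ⟨v, fun β => ?_⟩
  rw [← hv, map_sum, Finset.sum_eq_single β]
  · simp only [rightDiv_mul, rightDiv_arrow, nilCoeff_arrow, zero_smul, add_zero, if_true, map_mul,
      hq]
    exact (hb β).symm
  · intro a _ ha
    simp [rightDiv_mul, rightDiv_arrow, nilCoeff_arrow, ha]
  · simp

/-- The coefficients of the vertices on the Jacobian algebra. -/
def coeff (hW : W.IsClosed) (x : V) : JacobianAlgebra W →ₐ[k] k :=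
  lift (nilCoeff x) fun α => hW.nilCoeff_derivative α x

theorem coeff_mk (hW : W.IsClosed) (x : V) (f : PathAlgebra k V) :
    coeff hW x (mk W f) = nilCoeff x f :=
  lift_mk _ _ f

theorem coeff_e (hW : W.IsClosed) (x : V) : coeff hW x (e W x) = 1 := by
  classical
  rw [e, coeff_mk, nilCoeff_vertex, if_pos rfl]

theorem coeff_e_of_ne (hW : W.IsClosed) {x y : V} (h : y ≠ x) : coeff hW x (e W y) = 0 := by
  classical
  rw [e, coeff_mk, nilCoeff_vertex, if_neg h]

theorem coeff_arr (hW : W.IsClosed) (x : V) (a : Quiver.Total V) : coeff hW x (arr W a) = 0 := by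
  rw [arr, coeff_mk, nilCoeff_arrow]

theorem exists_eq_sum_e_add_sum_arr_mul (hW : W.IsClosed) (b : JacobianAlgebra W) :
    ∃ p : Quiver.Total V → JacobianAlgebra W,
      b = ∑ x, coeff hW x b • e W x + ∑ a, arr W a * p a := by
  obtain ⟨f, rfl⟩ := mk_surjective W b
  refine ⟨fun a => mk W (leftDiv a f), ?_⟩
  conv_lhs => rw [eq_sum_arrow_mul_leftDiv f]
  simp only [map_add, map_sum, map_smul, map_mul, coeff_mk]
  rfl

open Classical in
-- This provides the surjection onto the radical of `P(x)` from the free module on the arrows.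
theorem exists_eq_sum_arr_mul (hW : W.IsClosed) {x : V} {b : JacobianAlgebra W}
    (hb : e W x * b = b) (hb' : coeff hW x b = 0) :
    ∃ p : Quiver.Total V → JacobianAlgebra W,
      b = ∑ a, if a.left = x then arr W a * p a else 0 := by
  obtain ⟨p, hp⟩ := exists_eq_sum_e_add_sum_arr_mul hW b
  refine ⟨p, ?_⟩
  have h0 (y : V) : coeff hW y b = 0 := by
    by_cases h : x = y
    · rwa [← h]
    · rw [← hb, map_mul, coeff_e_of_ne hW h, zero_mul]
  simp only [h0, zero_smul, Finset.sum_const_zero, zero_add] at hp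
  rw [← hb]
  nth_rw 1 [hp]
  rw [Finset.mul_sum]
  refine Finset.sum_congr rfl fun a _ => ?_
  split_ifs with h
  · rw [← mul_assoc, ← h, e_mul_arr]
  · rw [← mul_assoc, e_mul_arr_of_ne W (Ne.symm h), zero_mul]

end JacobianAlgebra

/-! ### Weights of the arrows -/

/-- In a tree, a vertex has at most one neighbour that is closer to a given vertex. -/
theorem eq_of_adj_of_dist_lt {T : Type*} {G : SimpleGraph T} (hG : G.IsTree) {r v w₁ w₂ : T}
    (h₁ : G.Adj w₁ v) (h₂ : G.Adj w₂ v) (d₁ : G.dist r w₁ < G.dist r v)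
    (d₂ : G.dist r w₂ < G.dist r v) : w₁ = w₂ := by
  have key (w : T) (h : G.Adj w v) (d : G.dist r w < G.dist r v) :
      ∃ p : G.Walk r v, p.IsPath ∧ p.penultimate = w := by
    obtain ⟨p, hp⟩ := hG.connected.exists_walk_length_eq_dist r w
    -- A geodesic to the closer neighbour, prolonged by the edge, is again geodesic. Paths in a tree
    -- are unique, and so is their penultimate vertex.
    refine ⟨p.concat h, SimpleGraph.Walk.isPath_of_length_eq_dist _ ?_, by simp⟩
    rw [SimpleGraph.Walk.length_concat, hp]
    rcases hG.dist_eq_dist_add_one_of_adj r h with h | h <;> omega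
  obtain ⟨p₁, hp₁, rfl⟩ := key w₁ h₁ d₁
  obtain ⟨p₂, hp₂, rfl⟩ := key w₂ h₂ d₂
  rw [(hG.existsUnique_path r v).unique hp₁ hp₂]

section Weights

variable {V : Type u} [Quiver.{u} V]

theorem ChordlessCycle.cycle_nodup (C : ChordlessCycle V) : C.cycle.Nodup := by
  have h := C.nodup
  generalize C.cycle = c at h
  induction c using Quotient.inductionOn' with
  | h l => exact List.Nodup.of_map _ h

theorem ChordlessCycle.two_le_length (hQ : IsDimerTreeQuiver V) (C : ChordlessCycle V) :
    2 ≤ C.cycle.length := by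
  obtain ⟨c, h₁, h₂, _, _⟩ := C
  induction c using Quotient.inductionOn' with
  | h l =>
    match l, h₁, h₂ with
    | [], h₁, h₂ => exact absurd rfl h₁
    | [a], h₁, h₂ =>
      have : a.right = a.left := (Cycle.chain_singleton _ _).1 h₂
      obtain ⟨x, y, f⟩ := a
      obtain rfl : y = x := this
      exact ((hQ.no_loops _).false f).elim
    | a :: b :: l, h₁, h₂ => exact Nat.le_add_left 2 l.length

theorem ChordlessCycle.isClosedPath (hQ : IsDimerTreeQuiver V) (C : ChordlessCycle V) :
    IsClosedPath C.cycle :=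
  ⟨C.chain, C.two_le_length hQ⟩

open Classical in
/-- The set of arrows of a chordless cycle. -/
def ChordlessCycle.arrows (C : ChordlessCycle V) : Finset (Quiver.Total V) := C.cycle.toFinset

theorem ChordlessCycle.mem_arrows {C : ChordlessCycle V} {a : Quiver.Total V} :
    a ∈ C.arrows ↔ a ∈ C.cycle := by
  obtain ⟨c, _, _, _, _⟩ := C
  induction c using Quotient.inductionOn' with
  | h l => simp [arrows, Cycle.toFinset]

theorem ChordlessCycle.arrows_val (C : ChordlessCycle V) : C.arrows.val = C.cycle.toMultiset := by
  classical
  have h := C.cycle_nodup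
  rw [arrows, ← Cycle.toFinset_toMultiset, Multiset.toFinset_val, Multiset.dedup_eq_self]
  obtain ⟨c, _, _, _, _⟩ := C
  induction c using Quotient.inductionOn' with
  | h l => exact h

theorem ChordlessCycle.two_le_card_arrows (hQ : IsDimerTreeQuiver V) (C : ChordlessCycle V) :
    2 ≤ C.arrows.card := by
  rw [Finset.card, arrows_val, Cycle.card_toMultiset]
  exact C.two_le_length hQ

theorem adj_of_mem {C C' : ChordlessCycle V} (h : C ≠ C') {a : Quiver.Total V}
    (ha : a ∈ C.arrows) (ha' : a ∈ C'.arrows) :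
    (dualGraph V).Adj (Sum.inl C) (Sum.inl C') := by
  rw [dualGraph, SimpleGraph.fromRel_adj]
  exact ⟨fun h' => h (Sum.inl_injective h'),
    Or.inl ⟨a, ChordlessCycle.mem_arrows.1 ha, ChordlessCycle.mem_arrows.1 ha'⟩⟩

/-- Two arrows of a chordless cycle that lie in chordless cycles closer to the base cycle are
equal. -/
theorem eq_of_mem_of_dist_lt (hQ : IsDimerTreeQuiver V) {C₀ C C₁ C₂ : ChordlessCycle V}
    {a b : Quiver.Total V} (ha : a ∈ C.arrows) (hb : b ∈ C.arrows) (ha' : a ∈ C₁.arrows)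
    (hb' : b ∈ C₂.arrows)
    (h₁ : (dualGraph V).dist (Sum.inl C₀) (Sum.inl C₁) <
      (dualGraph V).dist (Sum.inl C₀) (Sum.inl C))
    (h₂ : (dualGraph V).dist (Sum.inl C₀) (Sum.inl C₂) <
      (dualGraph V).dist (Sum.inl C₀) (Sum.inl C)) : a = b := by
  have n₁ : C₁ ≠ C := by
    rintro rfl
    exact lt_irrefl _ h₁
  have n₂ : C₂ ≠ C := by
    rintro rfl
    exact lt_irrefl _ h₂
  obtain rfl : C₁ = C₂ := Sum.inl_injective
    (eq_of_adj_of_dist_lt hQ.isTree (adj_of_mem n₁ ha' ha) (adj_of_mem n₂ hb' hb) h₁ h₂)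
  exact hQ.no_double_edges C₁ C n₁ a b (ChordlessCycle.mem_arrows.1 ha')
    (ChordlessCycle.mem_arrows.1 ha) (ChordlessCycle.mem_arrows.1 hb')
    (ChordlessCycle.mem_arrows.1 hb)

/-- There are positive weights of the arrows such that the chordless cycles up to a given distance
from the base cycle have weight one. -/
theorem exists_weight_of_dist_lt (hQ : IsDimerTreeQuiver V) (C₀ : ChordlessCycle V) (n : ℕ) :
    ∃ w : Quiver.Total V → ℚ, (∀ a, 0 < w a ∧ w a < 1) ∧ ∀ C : ChordlessCycle V,
      (dualGraph V).dist (Sum.inl C₀) (Sum.inl C) < n → ∑ a ∈ C.arrows, w a = 1 := by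
  classical
  induction n with
  | zero => exact ⟨fun _ => 1 / 2, fun _ => by norm_num, fun C hC => absurd hC (Nat.not_lt_zero _)⟩
  | succ n ih =>
    obtain ⟨w, hw, hw'⟩ := ih
    let d (C : ChordlessCycle V) : ℕ := (dualGraph V).dist (Sum.inl C₀) (Sum.inl C)
    let old (a : Quiver.Total V) : Prop := ∃ C : ChordlessCycle V, d C < n ∧ a ∈ C.arrows
    -- What the old arrows leave of the total weight one is shared equally among the new arrows. A
    -- cycle at distance `n` has at most one old arrow and at least two arrows, so there are new
    -- ones; the bound `w < 1` keeps the remainder positive.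
    let val (C : ChordlessCycle V) : ℚ :=
      (1 - ∑ a ∈ C.arrows with old a, w a) / (C.arrows.filter fun a => ¬ old a).card
    have hcard (C : ChordlessCycle V) : (C.arrows.filter old).card +
        (C.arrows.filter fun a => ¬ old a).card = C.arrows.card :=
      Finset.card_filter_add_card_filter_not _
    have hold (C) (hC : d C = n) : (C.arrows.filter old).card ≤ 1 := by
      rw [Finset.card_le_one]
      intro a ha b hb
      obtain ⟨ha, C₁, h₁, ha'⟩ := Finset.mem_filter.1 ha
      obtain ⟨hb, C₂, h₂, hb'⟩ := Finset.mem_filter.1 hb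
      rw [← hC] at h₁ h₂
      exact eq_of_mem_of_dist_lt hQ ha hb ha' hb' h₁ h₂
    have hval (C) (hC : d C = n) : 0 < val C ∧ val C < 1 ∧
        ((C.arrows.filter fun a => ¬ old a).card : ℚ) ≠ 0 := by
      have h2 := C.two_le_card_arrows hQ
      have h1 := hold C hC
      have h3 := hcard C
      simp only [val]
      generalize hm : (C.arrows.filter fun a => ¬ old a).card = m at *
      have hm1 : (1 : ℚ) ≤ m := by exact_mod_cast (by omega : 1 ≤ m)
      have hm0 : (0 : ℚ) < m := by linarith
      rcases Nat.le_one_iff_eq_zero_or_eq_one.1 h1 with h0 | h0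
      · have hm2 : (2 : ℚ) ≤ m := by exact_mod_cast (by omega : 2 ≤ m)
        rw [Finset.card_eq_zero.1 h0, Finset.sum_empty, sub_zero]
        exact ⟨by positivity, (div_lt_one hm0).2 (by linarith), hm0.ne'⟩
      · obtain ⟨a, ha⟩ := Finset.card_eq_one.1 h0
        rw [ha, Finset.sum_singleton]
        have := hw a
        exact ⟨div_pos (by linarith) hm0, (div_lt_one hm0).2 (by linarith), hm0.ne'⟩
    let w' (a : Quiver.Total V) : ℚ := if old a then w a else
      if h : ∃ C : ChordlessCycle V, d C = n ∧ a ∈ C.arrows then val h.choose else 1 / 2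
    have hw'old (a) (ha : old a) : w' a = w a := if_pos ha
    have hw'new (C) (hC : d C = n) (a) (ha : a ∈ C.arrows) (h : ¬ old a) : w' a = val C := by
      have hex : ∃ C : ChordlessCycle V, d C = n ∧ a ∈ C.arrows := ⟨C, hC, ha⟩
      -- Cycles sharing an arrow are adjacent, and adjacent vertices of a tree have different
      -- distances from the base. Hence a new arrow lies in only one cycle at distance `n`.
      have : hex.choose = C := by
        by_contra hne
        exact hQ.isTree.dist_ne_of_adj (Sum.inl C₀) (adj_of_mem hne hex.choose_spec.2 ha)
          (hex.choose_spec.1.trans hC.symm)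
      simp only [w', if_neg h, dif_pos hex, this]
    refine ⟨w', fun a => ?_, fun C hC => ?_⟩
    · by_cases h : old a
      · rw [hw'old a h]
        exact hw a
      · by_cases hex : ∃ C : ChordlessCycle V, d C = n ∧ a ∈ C.arrows
        · obtain ⟨C, hC, ha⟩ := hex
          rw [hw'new C hC a ha h]
          exact ⟨(hval C hC).1, (hval C hC).2.1⟩
        · simp only [w', if_neg h, dif_neg hex]
          norm_num
    · rcases (Nat.lt_succ_iff_lt_or_eq.1 hC) with hlt | heq
      · rw [← hw' C hlt]
        exact Finset.sum_congr rfl fun a ha => hw'old a ⟨C, hlt, ha⟩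
      · rw [← Finset.sum_filter_add_sum_filter_not C.arrows old,
          Finset.sum_congr rfl fun a ha => hw'old a (Finset.mem_filter.1 ha).2,
          Finset.sum_congr rfl fun a ha => hw'new C heq a (Finset.mem_filter.1 ha).1
            (Finset.mem_filter.1 ha).2, Finset.sum_const, nsmul_eq_mul,
          mul_div_cancel₀ _ (hval C heq).2.2]
        ring

/-- There are positive weights of the arrows such that all chordless cycles have weight one. -/
theorem exists_weight [Finite V] [∀ v w : V, Finite (v ⟶ w)] (hQ : IsDimerTreeQuiver V)
    (C₀ : ChordlessCycle V) : ∃ w : Quiver.Total V → ℚ, (∀ a, 0 < w a) ∧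
      ∀ C : ChordlessCycle V, (C.cycle.toMultiset.map w).sum = 1 := by
  obtain ⟨w, hw, hw'⟩ := exists_weight_of_dist_lt hQ C₀ (Finset.univ.sup
    (fun C : ChordlessCycle V => (dualGraph V).dist (Sum.inl C₀) (Sum.inl C)) + 1)
  refine ⟨w, fun a => (hw a).1, fun C => ?_⟩
  rw [← C.arrows_val]
  exact hw' C (Nat.lt_succ_of_le (Finset.le_sup (f := fun C : ChordlessCycle V =>
    (dualGraph V).dist (Sum.inl C₀) (Sum.inl C)) (Finset.mem_univ C)))

end Weights

/-! ### Nilpotency of the arrow ideal -/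

section Nilpotent

open PathAlgebra

variable {k : Type u} [Field k] {V : Type u} [Quiver.{u} V] [Fintype V]

/-- The weight of a path. -/
def pathWeight (w : Quiver.Total V → ℚ) : ∀ {i j : V}, Quiver.Path i j → ℚ
  | _, _, Quiver.Path.nil => 0
  | _, _, Quiver.Path.cons (b := j) (c := l) p b => pathWeight w p + w ⟨j, l, b⟩

theorem pathWeight_comp (w : Quiver.Total V → ℚ) {i j l : V} (p : Quiver.Path i j)
    (q : Quiver.Path j l) : pathWeight w (p.comp q) = pathWeight w p + pathWeight w q := by
  induction q with
  | nil => simp [pathWeight]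
  | cons q b ih => rw [Quiver.Path.comp_cons, pathWeight, pathWeight, ih, add_assoc]

variable (W : Potential k V) (w : Quiver.Total V → ℚ)

/-- The map that records the weights of the paths, as a linear map. -/
def weightLinear : PathAlgebra k V →ₗ[k] AddMonoidAlgebra (JacobianAlgebra W) ℚ :=
  (basis k V).constr k fun p =>
    AddMonoidAlgebra.single (pathWeight w p.2.2) (JacobianAlgebra.mk W (ofPath k p.2.2))

theorem weightLinear_ofPath {i j : V} (p : Quiver.Path i j) :
    weightLinear W w (ofPath k p) =
      AddMonoidAlgebra.single (pathWeight w p) (JacobianAlgebra.mk W (ofPath k p)) :=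
  (basis k V).constr_basis k _ _

theorem weightLinear_mul (f g : PathAlgebra k V) :
    weightLinear W w (f * g) = weightLinear W w f * weightLinear W w g := by
  have h := bilinear_ext ((LinearMap.mul k (PathAlgebra k V)).compr₂ (weightLinear W w))
    ((LinearMap.mul k (AddMonoidAlgebra (JacobianAlgebra W) ℚ)).compl₁₂ (weightLinear W w)
      (weightLinear W w)) ?_ f g
  · simpa using h
  intro i j l m p q
  simp only [LinearMap.compr₂_apply, LinearMap.mul_apply', LinearMap.compl₁₂_apply,
    weightLinear_ofPath, AddMonoidAlgebra.single_mul_single, ← map_mul]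
  by_cases h : j = l
  · subst h
    rw [ofPath_mul_ofPath, weightLinear_ofPath, pathWeight_comp]
  · rw [ofPath_mul_ofPath_of_ne k p q h, map_zero, map_zero, AddMonoidAlgebra.single_zero]

/-- The homomorphism that records the weights of the paths. -/
def weightHom : PathAlgebra k V →ₐ[k] AddMonoidAlgebra (JacobianAlgebra W) ℚ :=
  AlgHom.ofLinearMap (weightLinear W w)
    (by
      simp only [one_def, map_sum, weightLinear_ofPath, pathWeight]
      rw [AddMonoidAlgebra.one_def, ← map_one (JacobianAlgebra.mk W), one_def, map_sum]
      exact (map_sum (AddMonoidAlgebra.singleAddHom 0) _ _).symm)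
    (weightLinear_mul W w)

theorem weightHom_ofPath {i j : V} (p : Quiver.Path i j) :
    weightHom W w (ofPath k p) =
      AddMonoidAlgebra.single (pathWeight w p) (JacobianAlgebra.mk W (ofPath k p)) :=
  weightLinear_ofPath W w p

theorem weightHom_vertex (x : V) : weightHom W w (vertex k x) =
    AddMonoidAlgebra.single 0 (JacobianAlgebra.mk W (vertex k x)) :=
  (weightHom_ofPath W w _).trans (by rw [pathWeight]; rfl)

theorem weightHom_arrow (a : Quiver.Total V) : weightHom W w (arrow k a) =
    AddMonoidAlgebra.single (w a) (JacobianAlgebra.mk W (arrow k a)) :=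
  (weightHom_ofPath W w _).trans (by
    rw [Quiver.Hom.toPath, pathWeight, pathWeight, zero_add]
    rfl)

theorem weightHom_prod (x : V) (l : List (Quiver.Total V)) :
    weightHom W w (vertex k x * (l.map (arrow k)).prod) =
      AddMonoidAlgebra.single (l.map w).sum
        (JacobianAlgebra.mk W (vertex k x * (l.map (arrow k)).prod)) := by
  induction l using List.reverseRecOn with
  | nil => simp [weightHom_vertex]
  | append_singleton l a ih =>
    rw [List.map_append, List.prod_append, ← mul_assoc, map_mul, ih, List.map_singleton,
      List.prod_singleton, weightHom_arrow, AddMonoidAlgebra.single_mul_single, ← map_mul,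
      List.map_append, List.sum_append, List.map_singleton, List.sum_singleton]

/-- All rotations have the same total weight, so the derivative is homogeneous. -/
theorem weightHom_cyclicDerivative (α : Quiver.Total V) (c : Cycle (Quiver.Total V)) :
    weightHom W w (cyclicDerivative k α c) =
      AddMonoidAlgebra.single ((c.toMultiset.map w).sum - w α)
        (JacobianAlgebra.mk W (cyclicDerivative k α c)) := by
  rw [cyclicDerivative_eq, map_multiset_sum, map_multiset_sum,
    ← AddMonoidAlgebra.singleAddHom_apply, map_multiset_sum, Multiset.map_map, Multiset.map_map, Multiset.map_map]
  congr 1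
  refine Multiset.map_congr rfl fun l hl => ?_
  rw [Cycle.mem_lists_iff_coe_eq] at hl
  subst hl
  cases l with
  | nil => simp [derivTerm]
  | cons a p =>
    simp only [Function.comp_apply, derivTerm, AddMonoidAlgebra.singleAddHom_apply]
    split_ifs with h
    · subst h
      rw [weightHom_prod]
      simp
    · simp

variable {W w}

/-- With all cycles of equal weight, a derivative sits in a single degree, with its class in the
Jacobian algebra, zero, as coefficient. Hence the weight homomorphism descends to that algebra. -/
theorem weightHom_derivative (hw : ∀ c ∈ W.support, (c.toMultiset.map w).sum = 1)
    (α : Quiver.Total V) : weightHom W w (W.derivative α) = 0 := by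
  have : weightHom W w (W.derivative α) =
      AddMonoidAlgebra.single (1 - w α) (JacobianAlgebra.mk W (W.derivative α)) := by
    rw [← AddMonoidAlgebra.singleAddHom_apply]
    simp only [Potential.derivative, Finsupp.sum, map_sum, map_smul]
    refine Finset.sum_congr rfl fun c hc => ?_
    rw [weightHom_cyclicDerivative, hw c hc, AddMonoidAlgebra.singleAddHom_apply,
      AddMonoidAlgebra.smul_single]
  rw [this, JacobianAlgebra.mk_derivative, AddMonoidAlgebra.single_zero]

theorem exists_length_mul_le_pathWeight [Finite (Quiver.Total V)] (hw : ∀ a, 0 < w a) :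
    ∃ r : ℚ, 0 < r ∧ ∀ {i j : V} (p : Quiver.Path i j), p.length * r ≤ pathWeight w p := by
  obtain ⟨r, hr, hr'⟩ : ∃ r : ℚ, 0 < r ∧ ∀ a, r ≤ w a := by
    cases isEmpty_or_nonempty (Quiver.Total V) with
    | inl h => exact ⟨1, one_pos, fun a => h.elim a⟩
    | inr h =>
      obtain ⟨a, ha⟩ := Finite.exists_min w
      exact ⟨w a, hw a, ha⟩
  refine ⟨r, hr, fun p => ?_⟩
  induction p with
  | nil => simp [pathWeight]
  | cons p b ih =>
    rw [Quiver.Path.length_cons, pathWeight]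
    push_cast
    linarith [hr' ⟨_, _, b⟩]

/-- Long paths vanish in a finite-dimensional Jacobian algebra with a positively weighted
potential. -/
theorem exists_mk_ofPath_eq_zero [Finite (Quiver.Total V)] [Module.Finite k (JacobianAlgebra W)]
    (hw : ∀ a, 0 < w a) (hw' : ∀ c ∈ W.support, (c.toMultiset.map w).sum = 1) :
    ∃ n : ℕ, ∀ {i j : V} (p : Quiver.Path i j), n ≤ p.length →
      JacobianAlgebra.mk W (ofPath k p) = 0 := by
  classical
  let θ := JacobianAlgebra.lift (weightHom W w) (weightHom_derivative hw')
  obtain ⟨S, hS⟩ := Module.Finite.fg_top (R := k) (M := JacobianAlgebra W)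
  -- The degrees occurring on a finite spanning set are the only ones that occur on the whole
  -- algebra.
  let Z : Finset ℚ := S.biUnion fun b => (θ b).coeff.support
  have hZ (b : JacobianAlgebra W) : ∀ q ∉ Z, (θ b).coeff q = 0 := by
    intro q hq
    have hb : b ∈ Submodule.span k (S : Set (JacobianAlgebra W)) := hS ▸ Submodule.mem_top
    induction hb using Submodule.span_induction with
    | mem b hb =>
      by_contra h
      exact hq (Finset.mem_biUnion.2 ⟨b, hb, Finsupp.mem_support_iff.2 h⟩)
    | zero => simp
    | add b c _ _ h₁ h₂ => simp [h₁, h₂]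
    | smul r b _ h => simp [h]
  obtain ⟨r, hr, hr'⟩ := exists_length_mul_le_pathWeight hw
  obtain ⟨m, hm⟩ := Z.exists_le
  obtain ⟨n, hn⟩ := exists_nat_gt (m / r)
  refine ⟨n, fun p hp => ?_⟩
  have h1 : pathWeight w p ∉ Z := by
    intro h
    have h2 := hm _ h
    have h3 := hr' p
    have h4 : m < n * r := (div_lt_iff₀ hr).1 hn
    have h5 : (n : ℚ) * r ≤ p.length * r :=
      mul_le_mul_of_nonneg_right (by exact_mod_cast hp) hr.le
    linarith
  -- The coefficient of a path in its own degree is the class of the path.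
  have := hZ (JacobianAlgebra.mk W (ofPath k p)) _ h1
  rw [JacobianAlgebra.lift_mk, weightHom_ofPath] at this
  simpa using this

end Nilpotent

namespace JacobianAlgebra

open PathAlgebra MulOpposite

variable {k : Type u} [Field k] {V : Type u} [Quiver.{u} V] [Fintype V] {W : Potential k V}

/-! ### Maps from the first syzygy of the radical of a projective module -/

section Relations

variable [Fintype (Quiver.Total V)]

open Classical in
/-- The map from a free module onto the radical of `P(x)` that is given by the arrows that start
at `x`. -/
def arrowMap (W : Potential k V) (x : V) :
    (Quiver.Total V → JacobianAlgebra W) →ₗ[(JacobianAlgebra W)ᵐᵒᵖ] JacobianAlgebra W where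
  toFun p := ∑ a, if a.left = x then arr W a * p a else 0
  map_add' p q := by
    rw [← Finset.sum_add_distrib]
    refine Finset.sum_congr rfl fun a _ => ?_
    split_ifs <;> simp [mul_add]
  map_smul' r p := by
    rw [Finset.smul_sum]
    refine Finset.sum_congr rfl fun a _ => ?_
    split_ifs <;> simp [smul_eq_mul_unop, mul_assoc]

open Classical in
/-- The projection of the free module on the arrows onto the projective cover of the radical
of `P(x)`. -/
def arrowProj (W : Potential k V) (x : V) :
    (Quiver.Total V → JacobianAlgebra W) →ₗ[(JacobianAlgebra W)ᵐᵒᵖ]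
      (Quiver.Total V → JacobianAlgebra W) where
  toFun p a := if a.left = x then e W a.right * p a else 0
  map_add' p q := by
    ext a
    simp only [Pi.add_apply]
    split_ifs <;> simp [mul_add]
  map_smul' r p := by
    ext a
    simp only [Pi.smul_apply, RingHom.id_apply]
    split_ifs <;> simp [smul_eq_mul_unop, mul_assoc]

theorem arrowMap_arrowProj (x : V) (p : Quiver.Total V → JacobianAlgebra W) :
    arrowMap W x (arrowProj W x p) = arrowMap W x p := by
  refine Finset.sum_congr rfl fun a _ => ?_
  simp only [arrowProj, LinearMap.coe_mk, AddHom.coe_mk]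
  split_ifs
  · rw [← mul_assoc, arr_mul_e]
  · rfl

theorem arrowProj_arrowProj (x : V) (p : Quiver.Total V → JacobianAlgebra W) :
    arrowProj W x (arrowProj W x p) = arrowProj W x p := by
  ext a
  simp only [arrowProj, LinearMap.coe_mk, AddHom.coe_mk]
  split_ifs
  · rw [← mul_assoc, e_mul_e]
  · rfl

theorem arrowMap_secondDerivative (hW : W.IsClosed) (x : V) (β : Quiver.Total V) :
    arrowMap W x (secondDerivative W β) = 0 := by
  have h := congrArg (e W x * ·) (sum_arr_mul_secondDerivative hW β)
  simp only [Finset.mul_sum, mul_zero] at h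
  rw [← h]
  refine Finset.sum_congr rfl fun a _ => ?_
  split_ifs with ha
  · rw [← mul_assoc, ← ha, e_mul_arr]
  · rw [← mul_assoc, e_mul_arr_of_ne W (Ne.symm ha), zero_mul]

/-- The second derivatives at `β` as a relation between the arrows that start at `x`. -/
def relation (hW : W.IsClosed) (x : V) (β : Quiver.Total V) : LinearMap.ker (arrowMap W x) :=
  ⟨arrowProj W x (secondDerivative W β), by
    rw [LinearMap.mem_ker, arrowMap_arrowProj, arrowMap_secondDerivative hW]⟩

theorem relation_smul_e (hW : W.IsClosed) (x : V) (β : Quiver.Total V) :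
    op (e W β.left) • relation hW x β = relation hW x β := by
  ext1
  simp only [relation, Submodule.coe_smul]
  rw [← map_smul]
  congr 1
  ext a
  exact secondDerivative_mul_e W hW a β

/-- The symmetry of second derivatives gives this relation among the relations; it constrains the
values of any map defined on them. -/
theorem sum_relation_smul_arr (hW : W.IsClosed) (x : V) :
    ∑ β, op (arr W β) • relation hW x β = 0 := by
  ext1
  simp only [relation, AddSubmonoidClass.coe_finsetSum, Submodule.coe_smul, ← map_smul]
  rw [← map_sum, Submodule.coe_zero]
  convert map_zero (arrowProj W x)
  ext a
  rw [Finset.sum_apply]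
  exact sum_secondDerivative_mul_arr hW a

/-- The projection onto the projective cover of the radical, on the relations. -/
theorem exists_arrowProj_eq_sum (hW : W.IsClosed) {x : V}
    (p : LinearMap.ker (arrowMap W x)) :
    ∃ v : Quiver.Total V → JacobianAlgebra W,
      (∀ a, arrowProj W x p a = ∑ β, secondDerivative W β a * v β) ∧
      arrowProj W x p = ((∑ β, op (v β) • relation hW x β : LinearMap.ker (arrowMap W x)) :
        Quiver.Total V → JacobianAlgebra W) := by
  obtain ⟨v, hv⟩ := exists_eq_sum_secondDerivative_mul hW x p.1 p.2
  refine ⟨v, hv, ?_⟩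
  simp only [relation, AddSubmonoidClass.coe_finsetSum, Submodule.coe_smul, ← map_smul]
  rw [← map_sum, ← arrowProj_arrowProj]
  congr 1
  ext a
  rw [Finset.sum_apply]
  exact hv a

/-- Every map from the relations between the arrows that start at `x` to the algebra extends to
the free module. -/
theorem exists_extension_arrowMap (hW : W.IsClosed) (x : V)
    (φ : LinearMap.ker (arrowMap W x) →ₗ[(JacobianAlgebra W)ᵐᵒᵖ] JacobianAlgebra W) :
    ∃ ψ, ψ ∘ₗ (LinearMap.ker (arrowMap W x)).subtype = φ := by
  obtain ⟨c, hc⟩ := exists_eq_sum_mul_secondDerivative hW (fun β => φ (relation hW x β))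
    (fun β => by
      conv_rhs => rw [← relation_smul_e, map_smul]
      rfl)
    (by
      have h := congrArg φ (sum_relation_smul_arr hW x)
      rw [map_sum, map_zero] at h
      rw [← h]
      exact Finset.sum_congr rfl fun β _ => by rw [map_smul, op_smul_eq_mul])
  -- On the relations given by second derivatives, `φ` is left multiplication by the row `c`, which
  -- makes sense on the whole free module.
  let ψ₀ : (Quiver.Total V → JacobianAlgebra W) →ₗ[(JacobianAlgebra W)ᵐᵒᵖ] JacobianAlgebra W :=
    { toFun := fun p => ∑ a, c a * p a
      map_add' := fun p q => by simp [mul_add, Finset.sum_add_distrib]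
      map_smul' := fun r p => by simp [smul_eq_mul_unop, Finset.sum_mul, mul_assoc] }
  -- The free module is larger than the projective cover of the radical. The complementary summand
  -- lies in the kernel, so `φ` itself can be used on it.
  let γ : (Quiver.Total V → JacobianAlgebra W) →ₗ[(JacobianAlgebra W)ᵐᵒᵖ]
      LinearMap.ker (arrowMap W x) := (LinearMap.id - arrowProj W x).codRestrict _ fun p => by
    rw [LinearMap.mem_ker, LinearMap.sub_apply, map_sub, arrowMap_arrowProj, LinearMap.id_apply,
      sub_self]
  refine ⟨ψ₀ ∘ₗ arrowProj W x + φ ∘ₗ γ, LinearMap.ext fun p => ?_⟩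
  obtain ⟨v, hv, hv'⟩ := exists_arrowProj_eq_sum hW p
  have h1 : p = ∑ β, op (v β) • relation hW x β + γ p := by
    ext1
    rw [Submodule.coe_add, ← hv']
    simp [γ]
  conv_rhs => rw [h1, map_add, map_sum]
  simp only [LinearMap.comp_apply, LinearMap.add_apply, Submodule.subtype_apply]
  congr 1
  change ∑ a, c a * arrowProj W x p a = _
  simp only [hv, map_smul, op_smul_eq_mul, hc, Finset.mul_sum, Finset.sum_mul, mul_assoc]
  exact Finset.sum_comm

end Relations

/-! ### Projective and simple modules -/

theorem mem_P_iff {x : V} {b : JacobianAlgebra W} : b ∈ P W x ↔ e W x * b = b := by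
  rw [P, Submodule.mem_span_singleton]
  constructor
  · rintro ⟨c, rfl⟩
    rw [smul_eq_mul_unop, ← mul_assoc]
    exact congrArg (· * unop c) (e_mul_e W x)
  · intro h
    exact ⟨op b, h⟩

/-- The algebra is free of rank one as a right module. -/
def opEquiv (W : Potential k V) :
    (JacobianAlgebra W)ᵐᵒᵖ ≃ₗ[(JacobianAlgebra W)ᵐᵒᵖ] JacobianAlgebra W where
  toFun := unop
  invFun := op
  map_add' _ _ := rfl
  map_smul' _ _ := rfl
  left_inv _ := rfl
  right_inv _ := rfl

instance : Module.Free (JacobianAlgebra W)ᵐᵒᵖ (JacobianAlgebra W) :=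
  Module.Free.of_equiv (opEquiv W)

instance (x : V) : Module.Projective (JacobianAlgebra W)ᵐᵒᵖ (P W x) := by
  let s : JacobianAlgebra W →ₗ[(JacobianAlgebra W)ᵐᵒᵖ] P W x :=
    LinearMap.codRestrict _ { toFun := fun b => e W x * b
                              map_add' := mul_add _
                              map_smul' := fun r b => by simp [smul_eq_mul_unop, mul_assoc] }
      fun b => by
        rw [mem_P_iff]
        simp [← mul_assoc, e_mul_e]
  refine Module.Projective.of_split (P W x).subtype s ?_
  ext b
  exact mem_P_iff.1 b.2

instance (x : V) : Module.Finite (JacobianAlgebra W)ᵐᵒᵖ (P W x) :=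
  Module.Finite.span_singleton _ _

variable (hW : W.IsClosed)

/-- The elements of `P(x)` without a component at the vertex `x`. -/
def radP (x : V) : Submodule (JacobianAlgebra W)ᵐᵒᵖ (P W x) where
  carrier := {b | coeff hW x b = 0}
  add_mem' {a b} ha hb := by
    simp only [Set.mem_ofPred_eq, Submodule.coe_add, map_add] at *
    rw [ha, hb, add_zero]
  zero_mem' := by simp
  smul_mem' r b hb := by
    simp only [Set.mem_ofPred_eq, Submodule.coe_smul, smul_eq_mul_unop, map_mul] at *
    rw [hb, zero_mul]

theorem mem_radP {x : V} {b : P W x} : b ∈ radP hW x ↔ coeff hW x b = 0 := Iff.rfl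

theorem coeff_eq_zero_of_ne [Fintype (Quiver.Total V)] {x y : V} (h : x ≠ y) (b : P W x) :
    coeff hW y b = 0 := by
  rw [← mem_P_iff.1 b.2, map_mul, coeff_e_of_ne hW h, zero_mul]

/-! ### Nilpotency and the radical of `P(x)` -/

variable {hW}

/-- The span of the long paths. -/
def pathSpan (W : Potential k V) (m : ℕ) : Submodule k (JacobianAlgebra W) :=
  Submodule.span k {b | ∃ (i j : V) (p : Quiver.Path i j), m ≤ p.length ∧ mk W (ofPath k p) = b}

/-- Without stationary components, `b` is a sum of products starting with an arrow, so multiplying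
by it lengthens paths. Thus the powers of `b` eventually vanish. -/
theorem mul_mem_pathSpan [Fintype (Quiver.Total V)] {m : ℕ} {b c : JacobianAlgebra W}
    (hc : c ∈ pathSpan W m) (hb : ∀ x, coeff hW x b = 0) : c * b ∈ pathSpan W (m + 1) := by
  obtain ⟨q, hq⟩ := exists_eq_sum_e_add_sum_arr_mul hW b
  simp only [hb, zero_smul, Finset.sum_const_zero, zero_add] at hq
  rw [hq, Finset.mul_sum]
  refine Submodule.sum_mem _ fun a _ => ?_
  obtain ⟨f, hf⟩ := mk_surjective W (q a)
  rw [← hf]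
  induction hc using Submodule.span_induction with
  | mem c hc =>
    obtain ⟨i, j, p, hp, rfl⟩ := hc
    rw [arr, ← map_mul, ← map_mul, ← mul_assoc]
    by_cases h : j = a.left
    · subst h
      rw [← ofPath_cons p a.hom]
      clear hf
      induction f using induction_on with
      | zero => simp
      | add f g hf hg =>
        rw [mul_add, map_add]
        exact add_mem hf hg
      | smul_path r i' j' q =>
        rw [mul_smul_comm, map_smul]
        refine Submodule.smul_mem _ _ ?_
        by_cases h : a.right = i'
        · subst h
          rw [ofPath_mul_ofPath]
          refine Submodule.subset_span ⟨_, _, _, ?_, rfl⟩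
          rw [Quiver.Path.length_comp, Quiver.Path.length_cons]
          omega
        · rw [ofPath_mul_ofPath_of_ne k _ _ h, map_zero]
          exact zero_mem _
    · rw [← vertex_mul_arrow a, ← mul_assoc (ofPath k p), ofPath_mul_vertex_of_ne p h, zero_mul,
        zero_mul, map_zero]
      exact zero_mem _
  | zero => simp
  | add c d _ _ h₁ h₂ =>
    rw [add_mul]
    exact add_mem h₁ h₂
  | smul r c _ h =>
    rw [smul_mul_assoc]
    exact Submodule.smul_mem _ _ h

/-- All paths of some length vanish. -/
def LongPathsVanish (W : Potential k V) : Prop :=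
  ∃ n : ℕ, ∀ {i j : V} (p : Quiver.Path i j), n ≤ p.length → mk W (ofPath k p) = 0

theorem LongPathsVanish.isNilpotent [Fintype (Quiver.Total V)] (hN : LongPathsVanish W)
    {b : JacobianAlgebra W} (hb : ∀ x, coeff hW x b = 0) : IsNilpotent b := by
  have h (m : ℕ) : b ^ m ∈ pathSpan W m := by
    induction m with
    | zero =>
      rw [pow_zero, ← sum_e]
      exact Submodule.sum_mem _ fun x _ =>
        Submodule.subset_span ⟨x, x, Quiver.Path.nil, Nat.zero_le _, rfl⟩
    | succ m ih =>
      rw [pow_succ]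
      exact mul_mem_pathSpan ih hb
  obtain ⟨n, hn⟩ := hN
  refine ⟨n, ?_⟩
  have hbot : pathSpan W n = ⊥ := by
    rw [pathSpan, Submodule.span_eq_bot]
    rintro _ ⟨i, j, p, hp, rfl⟩
    exact hn p hp
  have := h n
  rwa [hbot, Submodule.mem_bot] at this

variable [Fintype (Quiver.Total V)] (hN : LongPathsVanish W)

include hN in
-- `P(x)` is local: an element with nonzero coefficient `r` at `x` is `e_x` times the unit formed by
-- `r` and a nilpotent element, and therefore generates `P(x)`.
theorem le_radP {x : V} (N : Submodule (JacobianAlgebra W)ᵐᵒᵖ (P W x)) (h : N ≠ ⊤) :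
    N ≤ radP hW x := by
  intro b hb
  by_contra hc
  rw [mem_radP] at hc
  set r := coeff hW x b with hr
  have hj : IsNilpotent ((b : JacobianAlgebra W) - r • e W x) := by
    refine hN.isNilpotent (hW := hW) fun y => ?_
    by_cases h : x = y
    · subst h
      rw [map_sub, map_smul, coeff_e, hr, smul_eq_mul, mul_one, sub_self]
    · rw [map_sub, map_smul, coeff_e_of_ne hW h, coeff_eq_zero_of_ne hW h, smul_zero, sub_zero]
  have hu : IsUnit (algebraMap k (JacobianAlgebra W) r + (b - r • e W x)) :=
    hj.isUnit_add_left_of_commute ((IsUnit.mk0 r hc).map _) (Algebra.commutes' r _).symm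
  obtain ⟨u, hu⟩ := hu
  have h1 : e W x * (u : JacobianAlgebra W) = b := by
    rw [hu, mul_add, mul_sub, mem_P_iff.1 b.2, mul_smul_comm, e_mul_e, ← Algebra.commutes,
      Algebra.smul_def]
    abel
  refine h (eq_top_iff.2 fun c _ => ?_)
  have h2 : c = op ((↑u⁻¹ : JacobianAlgebra W) * c) • b := by
    ext
    rw [Submodule.coe_smul, op_smul_eq_mul, ← h1, mul_assoc, Units.mul_inv_cancel_left,
      mem_P_iff.1 c.2]
  rw [h2]
  exact N.smul_mem _ hb

include hN in
theorem radP_isCoatom (x : V) : IsCoatom (radP hW x) := by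
  refine ⟨fun h => ?_, fun N h => by_contra fun hN' => h.not_ge (le_radP hN N hN')⟩
  have : (⟨e W x, mem_P_iff.2 (e_mul_e W x)⟩ : P W x) ∈ radP hW x := h ▸ Submodule.mem_top
  rw [mem_radP, coeff_e] at this
  exact one_ne_zero this

include hN in
theorem jacobson_P (x : V) :
    Module.jacobson (JacobianAlgebra W)ᵐᵒᵖ (P W x) = radP hW x := by
  refine le_antisymm (sInf_le (radP_isCoatom hN x)) (le_sInf fun N hN' => ?_)
  by_contra h
  refine h (ge_of_eq ?_)
  exact ((le_radP hN N hN'.1).lt_or_eq.resolve_left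
    fun h' => (radP_isCoatom hN x).1 (hN'.2 _ h'))

include hN in
/-- Every simple module is the top of some `P(x)`. -/
theorem exists_surjective_of_isSimpleModule (S : Type u) [AddCommGroup S]
    [Module (JacobianAlgebra W)ᵐᵒᵖ S] [IsSimpleModule (JacobianAlgebra W)ᵐᵒᵖ S] :
    ∃ (x : V) (f : P W x →ₗ[(JacobianAlgebra W)ᵐᵒᵖ] S), Function.Surjective f ∧
      LinearMap.ker f = radP hW x := by
  -- If `v b` were nonzero it would generate the simple module, so `v b c = v` for some `c`; but `b
  -- c` is nilpotent.
  have hkill (b : JacobianAlgebra W) (hb : ∀ x, coeff hW x b = 0) (v : S) : op b • v = 0 := by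
    by_contra hv
    have hspan := IsSimpleModule.span_singleton_eq_top (JacobianAlgebra W)ᵐᵒᵖ hv
    obtain ⟨c, hc⟩ := Submodule.mem_span_singleton.1 (hspan ▸ Submodule.mem_top : v ∈ _)
    obtain ⟨n, hn⟩ := hN.isNilpotent (hW := hW) (b := b * unop c)
      (fun x => by rw [map_mul, hb, zero_mul])
    have h1 : op (b * unop c) • v = v := by
      rw [op_mul, op_unop, mul_smul, hc]
    have h2 (m : ℕ) : op ((b * unop c) ^ m) • v = v := by
      induction m with
      | zero => simp
      | succ m ih => rw [pow_succ', op_mul, mul_smul, h1, ih]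
    have h3 := h2 n
    rw [hn, op_zero, zero_smul] at h3
    exact hv (by rw [← h3, smul_zero])
  have := IsSimpleModule.nontrivial (JacobianAlgebra W)ᵐᵒᵖ S
  obtain ⟨v, hv⟩ := exists_ne (0 : S)
  obtain ⟨x, hx⟩ : ∃ x, op (e W x) • v ≠ 0 := by
    by_contra! h
    refine hv ?_
    have h1 : op (∑ x, e W x) • v = v := by rw [sum_e, op_one, one_smul]
    rw [← h1, Finset.op_sum, Finset.sum_smul]
    exact Finset.sum_eq_zero fun x _ => h x
  let f : P W x →ₗ[(JacobianAlgebra W)ᵐᵒᵖ] S :=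
    { toFun := fun b => op (b : JacobianAlgebra W) • v
      map_add' := fun a b => by simp [add_smul]
      map_smul' := fun r b => by
        rw [Submodule.coe_smul, smul_eq_mul_unop, op_mul, op_unop, mul_smul, RingHom.id_apply] }
  have hf : f ≠ 0 := fun h => hx (LinearMap.congr_fun h ⟨e W x, mem_P_iff.2 (e_mul_e W x)⟩)
  refine ⟨x, f, LinearMap.surjective_of_ne_zero hf, ?_⟩
  refine ((le_radP hN _ fun h => hf (LinearMap.ker_eq_top.1 h))).antisymm fun b hb => ?_
  refine hkill b (fun y => ?_) v
  by_cases h : x = y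
  · subst h
    exact hb
  · exact coeff_eq_zero_of_ne hW h b

/-! ### The algebra has injective dimension at most one -/

theorem arrowMap_mem_P (x : V) (p : Quiver.Total V → JacobianAlgebra W) :
    arrowMap W x p ∈ P W x := by
  rw [mem_P_iff]
  simp only [arrowMap, LinearMap.coe_mk, AddHom.coe_mk, Finset.mul_sum]
  refine Finset.sum_congr rfl fun a _ => ?_
  split_ifs with h
  · rw [← mul_assoc, ← h, e_mul_arr]
  · rw [mul_zero]

theorem coeff_arrowMap (x : V) (p : Quiver.Total V → JacobianAlgebra W) :
    coeff hW x (arrowMap W x p) = 0 := by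
  simp only [arrowMap, LinearMap.coe_mk, AddHom.coe_mk, map_sum]
  refine Finset.sum_eq_zero fun a _ => ?_
  split_ifs with h
  · rw [map_mul, coeff_arr, zero_mul]
  · rw [map_zero]

/-- The arrows present rad P(x) by a free module whose kernel consists of the relations, and
`exists_extension_arrowMap` extends maps from that kernel. -/
theorem subsingleton_ext_one_radP (x : V) :
    Subsingleton (Abelian.Ext (ModuleCat.of (JacobianAlgebra W)ᵐᵒᵖ (radP hW x))
      (ModuleCat.of (JacobianAlgebra W)ᵐᵒᵖ (JacobianAlgebra W)ᵐᵒᵖ) 1) := by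
  let g : (Quiver.Total V → JacobianAlgebra W) →ₗ[(JacobianAlgebra W)ᵐᵒᵖ] radP hW x :=
    ((arrowMap W x).codRestrict _ (arrowMap_mem_P x)).codRestrict _ (coeff_arrowMap x)
  have hg : LinearMap.range (LinearMap.ker (arrowMap W x)).subtype = LinearMap.ker g := by
    rw [Submodule.range_subtype]
    exact Submodule.ext fun p => ⟨fun h => Subtype.ext (Subtype.ext h),
      fun h => congrArg Subtype.val (congrArg Subtype.val h)⟩
  refine subsingleton_ext_one hg (Submodule.subtype_injective _) ?_ fun φ => ?_
  · rintro ⟨⟨b, hb⟩, hb'⟩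
    obtain ⟨p, hp⟩ := exists_eq_sum_arr_mul hW (mem_P_iff.1 hb) hb'
    exact ⟨p, Subtype.ext (Subtype.ext hp.symm)⟩
  · obtain ⟨ψ, hψ⟩ := exists_extension_arrowMap hW x ((opEquiv W).toLinearMap ∘ₗ φ)
    refine ⟨(opEquiv W).symm.toLinearMap ∘ₗ ψ, ?_⟩
    rw [LinearMap.comp_assoc, hψ, ← LinearMap.comp_assoc]
    simp

include hW hN in
theorem subsingleton_ext_two_of_isSimpleModule (S : Type u) [AddCommGroup S]
    [Module (JacobianAlgebra W)ᵐᵒᵖ S] [IsSimpleModule (JacobianAlgebra W)ᵐᵒᵖ S] :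
    Subsingleton (Abelian.Ext (ModuleCat.of (JacobianAlgebra W)ᵐᵒᵖ S)
      (ModuleCat.of (JacobianAlgebra W)ᵐᵒᵖ (JacobianAlgebra W)ᵐᵒᵖ) 2) := by
  obtain ⟨x, f, hf, hker⟩ := exists_surjective_of_isSimpleModule (hW := hW) hN S
  have := subsingleton_ext_one_radP (hW := hW) x
  have h : LinearMap.range (radP hW x).subtype = LinearMap.ker f := by
    rw [Submodule.range_subtype, hker]
  exact subsingleton_ext_succ h (Submodule.subtype_injective _) hf

include hW hN in
-- Vanishing on the simple factors propagates along a composition series, by exactness in the middle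
-- of the long exact sequence.
theorem subsingleton_ext_two_of_isFiniteLength {N : Type u} [AddCommGroup N]
    [Module (JacobianAlgebra W)ᵐᵒᵖ N] (hN' : IsFiniteLength (JacobianAlgebra W)ᵐᵒᵖ N) :
    Subsingleton (Abelian.Ext (ModuleCat.of (JacobianAlgebra W)ᵐᵒᵖ N)
      (ModuleCat.of (JacobianAlgebra W)ᵐᵒᵖ (JacobianAlgebra W)ᵐᵒᵖ) 2) := by
  induction hN' with
  | @of_subsingleton N =>
    have : Projective (ModuleCat.of (JacobianAlgebra W)ᵐᵒᵖ N) :=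
      (IsProjective.iff_projective _).mp inferInstance
    exact subsingleton_of_forall_eq 0 fun x => x.eq_zero_of_projective
  | @of_simple_quotient M _ _ N _ h ih =>
    have h2 := subsingleton_ext_two_of_isSimpleModule (hW := hW) hN (M ⧸ N)
    have hS := moduleShortComplex_shortExact (f := N.subtype) (g := N.mkQ) (by simp)
      (Submodule.subtype_injective _) (Submodule.mkQ_surjective _)
    refine subsingleton_of_forall_eq 0 fun x => ?_
    obtain ⟨y, rfl⟩ := Abelian.Ext.contravariant_sequence_exact₂ hS _ x
      (Subsingleton.elim (α := Abelian.Ext (ModuleCat.of (JacobianAlgebra W)ᵐᵒᵖ N)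
        (ModuleCat.of (JacobianAlgebra W)ᵐᵒᵖ (JacobianAlgebra W)ᵐᵒᵖ) 2) _ _)
    rw [Subsingleton.elim (α := Abelian.Ext (ModuleCat.of (JacobianAlgebra W)ᵐᵒᵖ (M ⧸ N))
      (ModuleCat.of (JacobianAlgebra W)ᵐᵒᵖ (JacobianAlgebra W)ᵐᵒᵖ) 2) y 0, Abelian.Ext.comp_zero]

include hW hN in
/-- `Ext²(N, B) = 0` for all finitely generated modules `N`. -/
theorem subsingleton_ext_two [Module.Finite k (JacobianAlgebra W)] (N : Type u) [AddCommGroup N]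
    [Module (JacobianAlgebra W)ᵐᵒᵖ N] [Module.Finite (JacobianAlgebra W)ᵐᵒᵖ N] :
    Subsingleton (Abelian.Ext (ModuleCat.of (JacobianAlgebra W)ᵐᵒᵖ N)
      (ModuleCat.of (JacobianAlgebra W)ᵐᵒᵖ (JacobianAlgebra W)ᵐᵒᵖ) 2) := by
  have : IsArtinianRing (JacobianAlgebra W)ᵐᵒᵖ := isArtinian_of_tower k inferInstance
  exact subsingleton_ext_two_of_isFiniteLength (hW := hW) hN
    (isFiniteLength_iff_isNoetherian_isArtinian.2 ⟨inferInstance, inferInstance⟩)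

end JacobianAlgebra

/-! ### Dimer tree algebras -/

section DimerTreeAlgebra

variable {k : Type u} [Field k] {V : Type u} [Fintype V] [Quiver.{u} V]
  [∀ v w : V, Finite (v ⟶ w)]

theorem exists_of_mem_support_dimerPotential {C₀ : ChordlessCycle V}
    {c : Cycle (Quiver.Total V)} (hc : c ∈ (dimerPotential k C₀).support) :
    ∃ C : ChordlessCycle V, C.cycle = c := by
  classical
  obtain ⟨C, -, hC⟩ := Finset.mem_biUnion.1 (Finsupp.support_finsetSum hc)
  exact ⟨C, (Finset.mem_singleton.1 (Finsupp.support_single_subset hC)).symm⟩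

theorem dimerPotential_isClosed (hQ : IsDimerTreeQuiver V) (C₀ : ChordlessCycle V) :
    (dimerPotential k C₀).IsClosed := by
  intro c hc
  obtain ⟨C, rfl⟩ := exists_of_mem_support_dimerPotential hc
  exact C.isClosedPath hQ

theorem dimerPotential_longPathsVanish (hQ : IsDimerTreeQuiver V) (C₀ : ChordlessCycle V)
    [Module.Finite k (DimerTreeAlgebra k C₀)] :
    JacobianAlgebra.LongPathsVanish (dimerPotential k C₀) := by
  obtain ⟨w, hw, hw'⟩ := exists_weight hQ C₀
  refine exists_mk_ofPath_eq_zero hw fun c hc => ?_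
  obtain ⟨C, rfl⟩ := exists_of_mem_support_dimerPotential hc
  exact hw' C

end DimerTreeAlgebra

/-! ### Extensions between a syzygy and a radical -/

section Radical

variable {R : Type u} [Ring R] [IsNoetherianRing R] {M P P₀ P₁ : Type u} [AddCommGroup M]
  [Module R M] [AddCommGroup P] [Module R P] [AddCommGroup P₀] [Module R P₀] [AddCommGroup P₁]
  [Module R P₁] [Module.Finite R P] [Module.Projective R P]

/-- The extensions between an indecomposable non-projective module in `CMP` and the largest proper
submodule `J` of a projective module `P` are determined by a minimal projective presentation. -/
theorem stableExt_ne_zero_iff_inAdd {J : Submodule R P} [IsSimpleModule R (P ⧸ J)]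
    (hJ : ∀ N : Submodule R P, N ≠ ⊤ → N ≤ J) (hJC : IsCMP R (ModuleCat.of R J))
    (hM : IsIndecomposable R M) (hMproj : ¬ Module.Projective R M)
    (hMC : IsCMP R (ModuleCat.of R M)) {d₁ : P₁ →ₗ[R] P₀} {d₀ : P₀ →ₗ[R] M}
    (hd : IsMinimalPresentation d₁ d₀) :
    ((∃ f : StableExt 1 ⟨_, hMC⟩ ⟨_, hJC⟩, f ≠ 0) ↔ InAdd R P P₀) ∧
      ((∃ f : StableExt 2 ⟨_, hMC⟩ ⟨_, hJC⟩, f ≠ 0) ↔ InAdd R P P₁) := by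
  constructor
  · rw [exists_stableExt_one_ne_zero_iff_not_liftsAlong,
      liftsAlong_iff_of_isIndecomposable hJ hM hMproj, inAdd_iff_of_isProjectiveCover hJ hd.cover₀]
  · have := hd.cover₀.projective
    have : Subsingleton (Abelian.Ext (ModuleCat.of R M) (ModuleCat.of R R) 1) := hMC.2 1 one_pos
    have hs := freeCover_surjective (⟨_, hMC⟩ : CMP R)
    -- The chosen syzygy comes from a free cover that need not be minimal, whereas the argument on
    -- simple tops needs the minimal one.
    have hiff : LiftsAlong (LinearMap.ker (freeCover (⟨_, hMC⟩ : CMP R))) J.mkQ ↔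
        LiftsAlong (LinearMap.ker d₀) J.mkQ :=
      ⟨fun h => h.ker J.mkQ_surjective hs hd.cover₀.surjective,
        fun h => h.ker J.mkQ_surjective hd.cover₀.surjective hs⟩
    -- By definition of the iterate, Ext² of `M` is Ext¹ of its syzygy.
    refine (exists_stableExt_one_ne_zero_iff_not_liftsAlong (syzygy ⟨_, hMC⟩) J hJC).trans ?_
    refine (not_congr hiff).trans ?_
    rw [liftsAlong_ker_iff hd.cover₀, ← hd.exact, inAdd_iff_of_isProjectiveCover hJ hd.cover₁]

end Radical
end DimerTree

end

/-! ### Assembly for dimer tree algebras -/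

theorem proposition5 {k : Type u} [Field k] [IsAlgClosed k]
    {V : Type u} [Fintype V] [Quiver.{u} V] [∀ v w : V, Finite (v ⟶ w)]
    (hQ : IsDimerTreeQuiver V) (C₀ : ChordlessCycle V)
    [Module.Finite k (DimerTreeAlgebra k C₀)]
    {M P₀ P₁ : Type u}
    [AddCommGroup M] [Module (DimerTreeAlgebra k C₀)ᵐᵒᵖ M]
    [AddCommGroup P₀] [Module (DimerTreeAlgebra k C₀)ᵐᵒᵖ P₀]
    [AddCommGroup P₁] [Module (DimerTreeAlgebra k C₀)ᵐᵒᵖ P₁]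
    [Module.Finite (DimerTreeAlgebra k C₀)ᵐᵒᵖ M]
    [Module.Finite (DimerTreeAlgebra k C₀)ᵐᵒᵖ P₀]
    [Module.Finite (DimerTreeAlgebra k C₀)ᵐᵒᵖ P₁]
    (hM : IsIndecomposable (DimerTreeAlgebra k C₀)ᵐᵒᵖ M)
    (hMsyz : IsSyzygy (DimerTreeAlgebra k C₀)ᵐᵒᵖ M)
    (hMproj : ¬ Module.Projective (DimerTreeAlgebra k C₀)ᵐᵒᵖ M)
    (d₁ : P₁ →ₗ[(DimerTreeAlgebra k C₀)ᵐᵒᵖ] P₀) (d₀ : P₀ →ₗ[(DimerTreeAlgebra k C₀)ᵐᵒᵖ] M)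
    (hd : IsMinimalPresentation d₁ d₀) (x : V) :
    ∃ (hMC : IsCMP (DimerTreeAlgebra k C₀)ᵐᵒᵖ (ModuleCat.of (DimerTreeAlgebra k C₀)ᵐᵒᵖ M))
      (hRC : IsCMP (DimerTreeAlgebra k C₀)ᵐᵒᵖ (ModuleCat.of (DimerTreeAlgebra k C₀)ᵐᵒᵖ
        (Module.jacobson (DimerTreeAlgebra k C₀)ᵐᵒᵖ
          (JacobianAlgebra.P (dimerPotential k C₀) x)))),
      ((∃ f : StableExt 1 ⟨_, hMC⟩ ⟨_, hRC⟩, f ≠ 0) ↔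
        InAdd (DimerTreeAlgebra k C₀)ᵐᵒᵖ (JacobianAlgebra.P (dimerPotential k C₀) x) P₀) ∧
      ((∃ f : StableExt 2 ⟨_, hMC⟩ ⟨_, hRC⟩, f ≠ 0) ↔
        InAdd (DimerTreeAlgebra k C₀)ᵐᵒᵖ (JacobianAlgebra.P (dimerPotential k C₀) x) P₁) := by
  have := Fintype.ofFinite (Quiver.Total V)
  have hW := dimerPotential_isClosed (k := k) hQ C₀
  have hN := dimerPotential_longPathsVanish (k := k) hQ C₀
  have hR := JacobianAlgebra.subsingleton_ext_two (hW := hW) hN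
  have hjac := JacobianAlgebra.jacobson_P (hW := hW) hN x
  have hle := JacobianAlgebra.le_radP (hW := hW) hN (x := x)
  have hsimple := isSimpleModule_iff_isCoatom.2 (JacobianAlgebra.radP_isCoatom (hW := hW) hN x)
  -- The radical in the statement is the Jacobson radical, which agrees with the elements of `P(x)`
  -- without component at `x`.
  rw [← hjac] at hle hsimple
  have hMC := hMsyz.isCMP hR
  have hRC := IsSyzygy.isCMP hR (A := Module.jacobson (DimerTreeAlgebra k C₀)ᵐᵒᵖ
    (JacobianAlgebra.P (dimerPotential k C₀) x))
    ⟨_, _, _, inferInstance, inferInstance, Submodule.subtype _, Submodule.subtype_injective _⟩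
  exact ⟨hMC, hRC, stableExt_ne_zero_iff_inAdd hle hRC hM hMproj hMC hd⟩
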